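/- **Setting.** Fix integers $b,n,\sigma,m,\bar c\ge 0$. At each stage $j=1,2,\dots$ two networks are used, one for long and one for short packets; each is a finite directed hypergraph with a source (Alice, who has no incoming hyperedges) and a different sink (Bob). Every hyperedge carries one packet to all its heads. Alice puts one packet on each hyperedge leaving her; every other node transmits on each outgoing hyperedge an independently drawn uniformly random $\mathbb F_q$-linear combination of the packets it receives. Let $M_j,\bar M_j$ be the min cuts from Alice to Bob, and $c_j,\bar c_j$ the numbers of hyperedges leaving Alice, in the long and the short network of stage $j$. Calvin adds arbitrary error packets on a set of hyperedges whose min cut to Bob is $z_j$ in the long and $\bar z_j$ in the short network. Assume $c_j,\bar c_j\le\bar c$, $z_j<M_j$, $\bar z_j<\bar M_j$ and $\sigma\le\bar M_j-\bar z_j$ for all $j$, and $\sigma m\ge 2b\bar c+2\sigma\bar c+1$. **Alice.** The message is $W\in\mathbb F_q^{b\times n}$, $X_0=(W\ I_b)$, and $w$ is $W$ with its columns stacked. The shared secret consists, for every stage $k$, of $2\alpha_k$ independent uniform symbols $d^{(k)}_u,h^{(k)}_u$, $1\le u\le\alpha_k=k\sigma m$, independent of the message. Put $D_k=[(d_u^{(k)})^v]_{u\le\alpha_k,\,v\le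 nb}$ and $l_k=h_k-D_kw$, the solution of $[D_k\ I](w;l_k)=h_k$. Arrange $l_k$ as a $\sigma\times km$ matrix $\mathcal L_k$, and let $L^{(i)}$ be the $i\sigma\times i(m+\sigma)$ matrix $(\mathcal L\ \ I_{i\sigma})$, where the $k$-th block row of $\mathcal L$ is $\mathcal L_k$ padded with zeros to width $im$. At stage $j$ Alice sends the rows of $K_jX_0$ as long packets and those of $G_jL^{(j)}$ as short packets, with uniformly random $K_j\in\mathbb F_q^{c_j\times b}$, $G_j\in\mathbb F_q^{\bar c_j\times j\sigma}$. **Calvin.** His injection places and error packets are arbitrary functions of $W$, of $l_1,\dots,l_i$, of all $K_j,G_j$ and of all network coefficients (hence of all transmissions), but not otherwise of the secret. **Bob.** Bob observes $Y_j=T_jK_jX_0+Q_jZ_j$ and $J_j=\bar T_jG_jL^{(j)}+\bar Q_jE_j$, where $T_j,Q_j,\bar T_j,\bar Q_j$ are the transfer matrices from Alice and from Calvin and $Z_j,E_j$ are the injected error packets. He stacks the $Y_j$ to $Y^{(i)}$ and the $J_j$, padded with zeros to the format of $L^{(i)}$, to $J^{(i)}$. From $Y^{(i)}$ he selects $r=\operatorname{rank}Y^{(i)}$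 independent rows and a basis of the column space made of the last $b$ columns $\hat T$ and $r-b$ of the others, $T''$; after permuting the columns, $$Y^{(i)}=[T''\ \hat T]\begin{bmatrix}I&F^Z&0\\0&F^X&I_b\end{bmatrix}.$$ From $J^{(i)}$ he gets $\hat{\bar T},F^E,F^A$ in the same way, with the last $i\sigma$ columns. If one of the two selections is impossible (in particular if $r<b$) he waits. Otherwise he solves the linear system $B(x_a,x_b,l_a,l_b)=(\hat{\mathbf T}f^X,\hat{\bar{\mathbf T}}f^A,h_1,\dots,h_i)$, consisting of the vectorized equations $$\hat TX_b=\hat T(F^X+X_aF^Z),\qquad \hat{\bar T}L_b=\hat{\bar T}(F^A+L_aF^E),\qquad D_kx+l_k=h_k\ \ (1\le k\le i),$$ where $X_a$, $X_b$ are the parts of an unknown $b\times n$ matrix (vectorized: $x$) in the columns selected and not selected, and $L_a,L_b$ are those of $\mathcal L$ (built from unknown $l_k$, with the zero padding kept). If there is no solution he waits, if there is exactly one he decodes the corresponding $X_0$, and if there are several he declares a failure. **Theorem.** Fix the parameters and networks above and a stage $i$. As $q\to\infty$ through the prime powers, uniformly in the field $\mathbb F_q$, the message $W$, Calvin's strategy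 and Bob's rule for selecting rows and columns: 1. If $b+\sum_{j=1}^iz_j\le\sum_{j=1}^iM_j$, then the probability that Bob's decoding attempt at stage $i$ returns $X_0$ tends to $1$. 2. If $b+\sum_{j=1}^iz_j>\sum_{j=1}^iM_j$, then the probability that at stage $i$ Bob either waits or returns $X_0$ tends to $1$; that is, with high probability he neither decodes an erroneous message nor declares a failure. 3. If the total number of long packets that reach Bob in the stages $1,\dots,i$ is less than $b+\sum_{j=1}^iz_j$ (when exactly $M_j$ packets reach him at stage $j$, this is the condition of 2), then with probability tending to $1$ the following holds: if the rows of $X_0$ and all long error packets injected by Calvin in these stages are linearly independent, then Bob waits at stage $i$. -/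

import Mathlib

open scoped Matrix BigOperators

noncomputable section

/-- Probability of the event `E` when all symbols making up `ω : Ω` are drawn independently and
uniformly from a finite field, i.e. when `ω` is uniform on the finite type `Ω`. -/
def prob {Ω : Type} [Finite Ω] (E : Ω → Prop) : ℝ :=
  (Nat.card {ω : Ω // E ω} : ℝ) / (Nat.card Ω : ℝ)

/-! ### Networks -/

/-- A finite directed hypergraph. A hyperedge is one packet transmission: the node `tail e` sends a
packet, and all nodes of `heads e` receive it. Alice is the node `source`, Bob the node `sink`.
Alice makes no use of packets that she overhears, so she is never listed among the receivers. -/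
structure Network where
  nodes : ℕ
  edges : ℕ
  tail : Fin edges → Fin nodes
  heads : Fin edges → Finset (Fin nodes)
  source : Fin nodes
  sink : Fin nodes
  source_ne_sink : source ≠ sink
  source_notMem_heads : ∀ e, source ∉ heads e

namespace Network

/-- The transmission opportunities of Alice. -/
abbrev Out (N : Network) : Type := {e : Fin N.edges // N.tail e = N.source}

/-- The transmissions received by Bob. -/
abbrev In (N : Network) : Type := {e : Fin N.edges // N.sink ∈ N.heads e}

/-- The min cut from Alice to Bob: the least number of hyperedges leaving a set of nodes that
contains Alice and not Bob. -/
def capacity (N : Network) : ℕ :=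
  sInf {k | ∃ S : Finset (Fin N.nodes), N.source ∈ S ∧ N.sink ∉ S ∧
    k = (Finset.univ.filter fun e => N.tail e ∈ S ∧ ¬ N.heads e ⊆ S).card}

/-- The min cut from Calvin to Bob, when Calvin injects errors on the hyperedges of `C`: as for
`capacity`, where the hyperedges of `C` are regarded as starting at an extra node (Calvin), which
always lies on the far side of the cut. -/
def errorCut (N : Network) (C : Finset (Fin N.edges)) : ℕ :=
  sInf {k | ∃ S : Finset (Fin N.nodes), N.sink ∉ S ∧
    k = (Finset.univ.filter fun e => (e ∈ C ∨ N.tail e ∈ S) ∧ ¬ N.heads e ⊆ S).card}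

/-- The local coding rule. The packet transmitted on `e` is the linear combination, with random
coefficients `a e e'`, of the packets on the hyperedges `e'` that reach `tail e`. -/
def mixing (N : Network) {F : Type} [Field F]
    (a : Matrix (Fin N.edges) (Fin N.edges) F) : Matrix (Fin N.edges) (Fin N.edges) F :=
  fun e e' => if N.tail e ∈ N.heads e' then a e e' else 0

/-- If `U` is the matrix of packets that are newly put on the hyperedges (by Alice or by Calvin),
then the matrix `P` of packets carried by the hyperedges solves `P = mixing * P + U`, so that
`P = (1 - mixing)⁻¹ * U`. (For an acyclic hypergraph, `mixing` is nilpotent.) -/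
def global (N : Network) {F : Type} [Field F]
    (a : Matrix (Fin N.edges) (Fin N.edges) F) : Matrix (Fin N.edges) (Fin N.edges) F :=
  (1 - N.mixing a)⁻¹

/-- The transfer matrix from Alice to Bob. -/
def transferT (N : Network) {F : Type} [Field F]
    (a : Matrix (Fin N.edges) (Fin N.edges) F) : Matrix N.In N.Out F :=
  (N.global a).submatrix Subtype.val Subtype.val

/-- The transfer matrix from Calvin, who injects on the hyperedges of `C`, to Bob. -/
def transferQ (N : Network) {F : Type} [Field F]
    (a : Matrix (Fin N.edges) (Fin N.edges) F) (C : Finset (Fin N.edges)) :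
    Matrix N.In {e // e ∈ C} F :=
  (N.global a).submatrix Subtype.val Subtype.val

/-- What Bob observes, `T * X + Q * Z`. Only the rows of `Z` that belong to `C` are used. -/
def observe (N : Network) {F : Type} [Field F] {κ : Type}
    (a : Matrix (Fin N.edges) (Fin N.edges) F) (X : Matrix N.Out κ F)
    (C : Finset (Fin N.edges)) (Z : Matrix (Fin N.edges) κ F) : Matrix N.In κ F :=
  N.transferT a * X + N.transferQ a C * Z.submatrix Subtype.val id

end Network

/-! ### Sessions

Stages are numbered from `0` in the code: `j` stands for the stage with number `j + 1`, and
"at stage `i`" means after the transmissions `j = 0, …, i - 1`. -/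

/-- The parameters of a session: `b` packets, each with `n` information symbols (and `b` symbols of
the identity matrix), the parameters `σ`, `m` of the short packets, and the networks that carry the
long and the short packets at each stage. -/
structure Session where
  b : ℕ
  n : ℕ
  σ : ℕ
  m : ℕ
  long : ℕ → Network
  short : ℕ → Network

namespace Session

/-- Columns of `X₀ = (W I_b)`. -/
abbrev LongCol (P : Session) : Type := Fin P.n ⊕ Fin P.b

/-- Columns of the short packets of the stage with number `k`, which have length `k (m + σ)`. -/
abbrev ShortCol (P : Session) (k : ℕ) : Type := Fin (k * P.m) ⊕ (Fin k × Fin P.σ)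

/-- Positions of the hash symbols of stage `k + 1`; there are `(k + 1) σ m` of them, arranged as a
`σ × (k + 1) m` matrix. -/
abbrev HashIdx (P : Session) (k : ℕ) : Type := Fin P.σ × Fin ((k + 1) * P.m)

/-- The raw source data `W`. -/
abbrev Message (P : Session) (F : Type) : Type := Matrix (Fin P.b) (Fin P.n) F

/-- The suffix vectors `l_1, …, l_i`. -/
abbrev Suffixes (P : Session) (F : Type) (i : ℕ) : Type := ∀ k : Fin i, P.HashIdx k → F

/-- The public randomness of the first `i` stages: the matrices `K_j`, `G_j` drawn by Alice and the
local coding coefficients drawn by the nodes of the networks. -/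
structure Coding (P : Session) (F : Type) (i : ℕ) where
  K : ∀ j : Fin i, Matrix (P.long j).Out (Fin P.b) F
  G : ∀ j : Fin i, Matrix (P.short j).Out (Fin (j + 1) × Fin P.σ) F
  aLong : ∀ j : Fin i, Matrix (Fin (P.long j).edges) (Fin (P.long j).edges) F
  aShort : ∀ j : Fin i, Matrix (Fin (P.short j).edges) (Fin (P.short j).edges) F

/-- The random symbols shared secretly by Alice and Bob. -/
structure Secret (P : Session) (F : Type) (i : ℕ) where
  d : ∀ k : Fin i, P.HashIdx k → F
  h : ∀ k : Fin i, P.HashIdx k → F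

instance (P : Session) (F : Type) [Finite F] (i : ℕ) : Finite (P.Coding F i) :=
  Finite.of_injective (fun c => (c.K, c.G, c.aLong, c.aShort)) (by
    rintro ⟨a, b, c, d⟩ ⟨a', b', c', d'⟩ h
    simp only [Prod.mk.injEq] at h
    obtain ⟨rfl, rfl, rfl, rfl⟩ := h
    rfl)

instance (P : Session) (F : Type) [Finite F] (i : ℕ) : Finite (P.Secret F i) :=
  Finite.of_injective (fun s => (s.d, s.h)) (by
    rintro ⟨a, b⟩ ⟨a', b'⟩ h
    simp only [Prod.mk.injEq] at h
    obtain ⟨rfl, rfl⟩ := h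
    rfl)

/-! ### Alice -/

/-- `X₀ = (W I_b)`. -/
def X0 (P : Session) {F : Type} [Field F] (W : P.Message F) : Matrix (Fin P.b) P.LongCol F :=
  Matrix.fromCols W 1

/-- The parity check matrix with rows `(d_u, d_u ^ 2, …, d_u ^ (n b))`. Its columns are indexed by
the entries of `vec W` (columns of `W` stacked on top of one another). -/
def parity (P : Session) {F : Type} [Field F] {k : ℕ} (d : P.HashIdx k → F) :
    Matrix (P.HashIdx k) (Fin P.n × Fin P.b) F :=
  fun u p => d u ^ ((finProdFinEquiv p : ℕ) + 1)

/-- `l_k = h_k - D_k w`, the solution of `[D_k I] (w; l_k) = h_k`. -/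
def suffix (P : Session) {F : Type} [Field F] {i : ℕ} (s : P.Secret F i) (W : P.Message F) :
    P.Suffixes F i :=
  fun k => s.h k - P.parity (s.d k) *ᵥ Matrix.vec W

/-- `L^(k) = (𝓛 I_{kσ})`: row block `j` is `l_j`, arranged as a `σ × (j + 1) m` matrix, padded with
zeros up to width `k m`, and followed by the `j`-th row block of the identity matrix. -/
def suffixMatrix (P : Session) {F : Type} [Field F] {k : ℕ} (l : P.Suffixes F k) :
    Matrix (Fin k × Fin P.σ) (P.ShortCol k) F :=
  Matrix.fromCols
    (fun r c => if hc : (c : ℕ) < (r.1 + 1) * P.m then l r.1 (r.2, ⟨c, hc⟩) else 0) 1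

/-- The first `j + 1` suffixes. -/
def prefixSuffixes (P : Session) {F : Type} {i : ℕ} (l : P.Suffixes F i) (j : Fin i) :
    P.Suffixes F (j + 1) :=
  fun k => l (Fin.castLE j.2 k)

/-! ### Calvin -/

/-- A strategy of Calvin for the first `i` stages. Calvin knows everything except the secret: the
places where he injects and the packets that he injects are arbitrary functions of the public
randomness and of the suffixes, hence of everything that is transmitted (a strategy is chosen after
the message, so it may depend on the message as well). -/
structure Calvin (P : Session) (F : Type) (i : ℕ) where
  locLong : P.Coding F i → P.Suffixes F i → ∀ j : Fin i, Finset (Fin (P.long j).edges)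
  locShort : P.Coding F i → P.Suffixes F i → ∀ j : Fin i, Finset (Fin (P.short j).edges)
  Z : P.Coding F i → P.Suffixes F i →
    ∀ j : Fin i, Matrix (Fin (P.long j).edges) P.LongCol F
  E : P.Coding F i → P.Suffixes F i →
    ∀ j : Fin i, Matrix (Fin (P.short j).edges) (P.ShortCol (j + 1)) F

/-- At each stage `j` the min cut from Calvin to Bob is `z j` for long packets and `zs j` for
short packets. -/
def Calvin.HasCuts {P : Session} {F : Type} {i : ℕ} (A : P.Calvin F i) (z zs : ℕ → ℕ) : Prop :=
  ∀ c l, ∀ j : Fin i, (P.long j).errorCut (A.locLong c l j) = z j ∧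
    (P.short j).errorCut (A.locShort c l j) = zs j

/-- The rows of `X₀` and all long packets injected by Calvin are linearly independent. -/
def Calvin.GenuineErrors {P : Session} {F : Type} [Field F] {i : ℕ} (A : P.Calvin F i)
    (W : P.Message F) (c : P.Coding F i) (l : P.Suffixes F i) : Prop :=
  LinearIndependent F (Sum.elim (P.X0 W)
    (fun e : Σ j : Fin i, {e // e ∈ A.locLong c l j} => A.Z c l e.1 e.2.1))

/-! ### What Bob receives -/

/-- `Y^(i)`: the stacked observations `Y_j = T_j X_j + Q_j Z_j` with `X_j = K_j X₀`. -/
def recvLong (P : Session) {F : Type} [Field F] {i : ℕ} (W : P.Message F) (A : P.Calvin F i)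
    (c : P.Coding F i) (l : P.Suffixes F i) :
    Matrix (Σ j : Fin i, (P.long j).In) P.LongCol F :=
  fun e => (P.long e.1).observe (c.aLong e.1) (c.K e.1 * P.X0 W)
    (A.locLong c l e.1) (A.Z c l e.1) e.2

/-- A short packet of stage `j + 1`, padded with zeros to the format of stage `i`. -/
def pad (P : Session) {F : Type} [Field F] {i : ℕ} (j : Fin i) (v : P.ShortCol (j + 1) → F) :
    P.ShortCol i → F
  | Sum.inl x => if hx : (x : ℕ) < (j + 1) * P.m then v (Sum.inl ⟨x, hx⟩) else 0
  | Sum.inr y => if hy : (y.1 : ℕ) < j + 1 then v (Sum.inr (⟨y.1, hy⟩, y.2)) else 0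

/-- `J^(i)`: the padded and stacked observations `J_j = T_j A_j + Q_j E_j` with
`A_j = G_j L^(j)`. -/
def recvShort (P : Session) {F : Type} [Field F] {i : ℕ} (A : P.Calvin F i)
    (c : P.Coding F i) (l : P.Suffixes F i) :
    Matrix (Σ j : Fin i, (P.short j).In) (P.ShortCol i) F :=
  fun e => P.pad e.1 ((P.short e.1).observe (c.aShort e.1)
    (c.G e.1 * P.suffixMatrix (P.prefixSuffixes l e.1))
    (A.locShort c l e.1) (A.E c l e.1) e.2)

end Session

/-! ### Bob -/

/-- The expansion `Y = [T'' T̂] [I Fz 0; 0 Fx I]` of a matrix with columns `α ⊕ β`: Bob selects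
`rank Y` linearly independent rows, and a set `col` of columns in `α` that together with all the
columns in `β` forms a basis of the column space; the columns outside `col` are expanded with
respect to this basis. (Such a selection exists if and only if the columns in `β` are linearly
independent; in particular, the rank is then at least `card β`.) -/
structure Expansion {F : Type} [Field F] {ρ α β : Type} [Fintype α] [Fintype β] [DecidableEq α]
    (Y : Matrix ρ (α ⊕ β) F) where
  row : Fin Y.rank → ρ
  row_indep : LinearIndependent F (fun t => Y (row t))
  col : Finset α
  col_indep : LinearIndependent F
    (Sum.elim (fun (a : {a // a ∈ col}) (t : Fin Y.rank) => Y (row t) (Sum.inl a.1))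
      (fun (s : β) (t : Fin Y.rank) => Y (row t) (Sum.inr s)))
  card_col : col.card + Fintype.card β = Y.rank
  Fz : Matrix {a // a ∈ col} {a // a ∉ col} F
  Fx : Matrix β {a // a ∉ col} F
  expand : Y.submatrix row (fun a : {a // a ∉ col} => Sum.inl a.1) =
    Y.submatrix row (fun a : {a // a ∈ col} => Sum.inl a.1) * Fz + Y.submatrix row Sum.inr * Fx

namespace Expansion

/-- `T̂`, the columns in `β` of the selected rows. -/
def That {F : Type} [Field F] {ρ α β : Type} [Fintype α] [Fintype β] [DecidableEq α]
    {Y : Matrix ρ (α ⊕ β) F} (e : Expansion Y) : Matrix (Fin Y.rank) β F :=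
  Y.submatrix e.row Sum.inr

/-- The matrix `B_top` (and `B_mid`): the block in block row `x ∉ col` and block column `a` is
`-Fz a x • T̂` for `a ∈ col`; for `a ∉ col` it is `T̂` if `a = x` and `0` otherwise. It acts on
vectorized `β × α` matrices. -/
def block {F : Type} [Field F] {ρ α β : Type} [Fintype α] [Fintype β] [DecidableEq α]
    {Y : Matrix ρ (α ⊕ β) F} (e : Expansion Y) :
    Matrix ({a // a ∉ e.col} × Fin Y.rank) (α × β) F :=
  fun xt as => if ha : as.1 ∈ e.col then -(e.Fz ⟨as.1, ha⟩ xt.1 * e.That xt.2 as.2)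
    else if as.1 = xt.1.1 then e.That xt.2 as.2 else 0

/-- `diag[T̂, …, T̂] fx`, where `fx` is the vectorized `Fx`. -/
def rhs {F : Type} [Field F] {ρ α β : Type} [Fintype α] [Fintype β] [DecidableEq α]
    {Y : Matrix ρ (α ⊕ β) F} (e : Expansion Y) : {a // a ∉ e.col} × Fin Y.rank → F :=
  Matrix.vec (e.That * e.Fx)

end Expansion

/-- The possible results of a decoding attempt. -/
inductive Outcome (M : Type) where
  | wait : Outcome M
  | decoded (X : M) : Outcome M
  | failure : Outcome M

namespace Session

/-- Positions of the unknowns `(x; l_1; …; l_i)`, where `x` is the vectorized `W`. The vectors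
`x_a`, `x_b` are the parts of `x` belonging to the columns in, respectively outside, `col`, and
similarly for `l_a`, `l_b`. -/
abbrev Unknown (P : Session) (i : ℕ) : Type :=
  (Fin P.n × Fin P.b) ⊕ (Σ k : Fin i, P.HashIdx k)

/-- The position of the hash symbol `u` in the vectorized matrix `𝓛`; the positions not of this
form are those of the dummy zeros. -/
def hashPos (P : Session) {i : ℕ} (u : Σ k : Fin i, P.HashIdx k) :
    Fin (i * P.m) × (Fin i × Fin P.σ) :=
  (Fin.castLE (Nat.mul_le_mul_right P.m u.1.2) u.2.2, (u.1, u.2.1))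

/-- `B_bot`, with block rows `[D_k 0 … I … 0]`. -/
def botMatrix (P : Session) {F : Type} [Field F] {i : ℕ} (s : P.Secret F i) :
    Matrix (Σ k : Fin i, P.HashIdx k) (P.Unknown i) F :=
  Matrix.fromCols (fun u p => P.parity (s.d u.1) u.2 p) 1

/-- The matrix `B` of Bob's linear system. -/
def sysMatrix (P : Session) {F : Type} [Field F] {i : ℕ} {ρ ρ' : Type}
    {Y : Matrix ρ P.LongCol F} {J : Matrix ρ' (P.ShortCol i) F}
    (eY : Expansion Y) (eJ : Expansion J) (s : P.Secret F i) :
    Matrix ((({a // a ∉ eY.col} × Fin Y.rank) ⊕ ({a // a ∉ eJ.col} × Fin J.rank)) ⊕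
      (Σ k : Fin i, P.HashIdx k)) (P.Unknown i) F :=
  Matrix.fromRows
    (Matrix.fromBlocks eY.block 0 0 (eJ.block.submatrix id P.hashPos))
    (P.botMatrix s)

/-- The right-hand side of Bob's linear system. -/
def sysRhs (P : Session) {F : Type} [Field F] {i : ℕ} {ρ ρ' : Type}
    {Y : Matrix ρ P.LongCol F} {J : Matrix ρ' (P.ShortCol i) F}
    (eY : Expansion Y) (eJ : Expansion J) (s : P.Secret F i) :
    (({a // a ∉ eY.col} × Fin Y.rank) ⊕ ({a // a ∉ eJ.col} × Fin J.rank)) ⊕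
      (Σ k : Fin i, P.HashIdx k) → F :=
  Sum.elim (Sum.elim eY.rhs eJ.rhs) (fun u => s.h u.1 u.2)

open Classical in
/-- Bob's attempt to solve the linear system: he waits if there is no solution, decodes if there is
exactly one, and declares a failure otherwise. -/
def solve (P : Session) {F : Type} [Field F] {i : ℕ} {ρ ρ' : Type}
    {Y : Matrix ρ P.LongCol F} {J : Matrix ρ' (P.ShortCol i) F}
    (eY : Expansion Y) (eJ : Expansion J) (s : P.Secret F i) :
    Outcome (Matrix (Fin P.b) P.LongCol F) :=
  if h : ∃! v : P.Unknown i → F, P.sysMatrix eY eJ s *ᵥ v = P.sysRhs eY eJ s then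
    Outcome.decoded (P.X0 (Matrix.of fun r x => h.choose (Sum.inl (x, r))))
  else if ∃ v : P.Unknown i → F, P.sysMatrix eY eJ s *ᵥ v = P.sysRhs eY eJ s then
    Outcome.failure
  else Outcome.wait

/-- The way in which Bob selects rows and columns of the matrices `Y^(i)`, `J^(i)`, if a selection
is possible at all. -/
structure Selection (P : Session) (F : Type) [Field F] (i : ℕ) where
  pickLong : ∀ Y : Matrix (Σ j : Fin i, (P.long j).In) P.LongCol F,
    Nonempty (Expansion Y) → Expansion Y
  pickShort : ∀ J : Matrix (Σ j : Fin i, (P.short j).In) (P.ShortCol i) F,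
    Nonempty (Expansion J) → Expansion J

open Classical in
/-- Bob's decoding attempt at stage `i`. He waits if one of the expansions is not possible, in
particular if the rank of `Y^(i)` is less than `b`. -/
def decode (P : Session) {F : Type} [Field F] {i : ℕ} (sel : P.Selection F i)
    (Y : Matrix (Σ j : Fin i, (P.long j).In) P.LongCol F)
    (J : Matrix (Σ j : Fin i, (P.short j).In) (P.ShortCol i) F) (s : P.Secret F i) :
    Outcome (Matrix (Fin P.b) P.LongCol F) :=
  if h : Nonempty (Expansion Y) ∧ Nonempty (Expansion J) then
    P.solve (sel.pickLong Y h.1) (sel.pickShort J h.2) s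
  else Outcome.wait

/-- The result of Bob's decoding attempt at stage `i`, as a function of all random symbols. -/
def result (P : Session) {F : Type} [Field F] {i : ℕ} (W : P.Message F) (A : P.Calvin F i)
    (sel : P.Selection F i) (ω : P.Coding F i × P.Secret F i) :
    Outcome (Matrix (Fin P.b) P.LongCol F) :=
  P.decode sel (P.recvLong W A ω.1 (P.suffix ω.2 W)) (P.recvShort A ω.1 (P.suffix ω.2 W)) ω.2

end Session

end

/-! Bob's linear system is a disguised membership test. Its solutions are exactly the messages `W'`,
with their forced suffixes, for which the rows of `(W' I)` lie in the row space of `Y` and the rows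
of the suffix matrix of `W'` lie in the row space of `J` (`sysMatrix_mulVec_eq_iff`). So the outcome
depends only on the set of such plausible messages: none means waiting, the true one alone means
decoding. Three facts about this set give the theorem.

No wrong message is plausible (`prob_exists_plausible_ne_le`). Since `h` is uniform, the suffixes
reveal nothing about `d`. Once the coding and the suffixes are fixed, so are Calvin's actions, `Y`
and `J`, while `d` is still uniform. A wrong message `w'` with suffixes `l'` must satisfy `D (w -
w') = l' - l`. These are `H = σ m i (i+1) / 2` independent polynomial conditions, each of
probability at most `n b / q`. The ranks of `Y` and `J` limit the number of candidate pairs to `q ^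
(H - 1)`, by the hypothesis on `σ m`, and a union bound remains.

The true message is plausible if the capacity suffices. For long packets, the columns of the stacked
`T_j K_j` must be independent modulo those of the `Q_j`. A vector `K_j v` is uniform for `v ≠ 0`,
and the vectors that Calvin can imitate have codimension at least `M_j - z_j`
(`exists_prob_long_not_separated_le`). Short packets are treated stage by stage: each stage has room
for its own `σ` new rows, and the older rows are known by induction
(`suffixMatrix_mem_rowSpace_recvShort`).

Genuine errors take up room. If a combination of received rows gives `X₀`, linear independence
forces it to annihilate every `Q_j`, and counting ranks gives `b + ∑ z_j ≤` the number of packets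
received (`card_le_of_genuineErrors`). Otherwise not even the true message is plausible.

Underneath lies the fact that, for random coefficients, the transfer matrices from all sets of
hyperedges have rank equal to the min cut (`prob_rank_transferQ_ne_le`). A transfer matrix is a
block of `(1 - mixing)⁻¹`, so its rank is given by the complementary block of the sparse matrix `1 -
mixing`, whose generic rank is a matching number. Hall's theorem replaces Menger's, and cycles do no
harm. All sets are treated at once because Calvin chooses after seeing the coefficients. -/

noncomputable section

/-! ### Elementary probability -/

section Probability

variable {Ω : Type} [Finite Ω]

theorem prob_mono {E E' : Ω → Prop} (h : ∀ ω, E ω → E' ω) : prob E ≤ prob E' := by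
  unfold prob
  gcongr
  exact Nat.card_mono (Set.toFinite {ω | E' ω}) h

theorem prob_le_one (E : Ω → Prop) : prob E ≤ 1 := by
  unfold prob
  refine div_le_one_of_le₀ ?_ (Nat.cast_nonneg _)
  exact_mod_cast Finite.card_subtype_le E

theorem prob_or_le (E E' : Ω → Prop) : prob (fun ω => E ω ∨ E' ω) ≤ prob E + prob E' := by
  unfold prob
  rw [← add_div]
  gcongr
  exact_mod_cast Set.ncard_union_le {ω | E ω} {ω | E' ω}

theorem prob_false : prob (fun _ : Ω => False) = 0 := by
  simp [prob]

theorem prob_exists_finset_le {ι : Type*} (s : Finset ι) (E : ι → Ω → Prop) {δ : ℝ}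
    (h : ∀ x ∈ s, prob (E x) ≤ δ) : prob (fun ω => ∃ x ∈ s, E x ω) ≤ s.card * δ := by
  classical
  induction s using Finset.induction_on with
  | empty => simp [prob_false]
  | insert a s ha ih =>
    have h1 := prob_or_le (E a) (fun ω => ∃ x ∈ s, E x ω)
    have h2 := ih fun x hx => h x (Finset.mem_insert_of_mem hx)
    have h3 := h a (Finset.mem_insert_self _ _)
    have h4 : prob (fun ω => ∃ x ∈ insert a s, E x ω) ≤
        prob (fun ω => E a ω ∨ ∃ x ∈ s, E x ω) := prob_mono fun ω => by simp
    rw [Finset.card_insert_of_notMem ha]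
    push_cast
    linarith

theorem prob_exists_le {ι : Type*} [Fintype ι] (E : ι → Ω → Prop) {δ : ℝ}
    (h : ∀ x, prob (E x) ≤ δ) : prob (fun ω => ∃ x, E x ω) ≤ Fintype.card ι * δ := by
  simpa using prob_exists_finset_le Finset.univ E fun x _ => h x

theorem one_sub_le_prob [Nonempty Ω] {E : Ω → Prop} {ε : ℝ} (h : prob (fun ω => ¬ E ω) ≤ ε) :
    1 - ε ≤ prob E := by
  have h1 := prob_or_le E (fun ω => ¬ E ω)
  have h2 : prob (fun ω => E ω ∨ ¬ E ω) = 1 := by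
    have : (Nat.card Ω : ℝ) ≠ 0 := by exact_mod_cast Nat.card_pos.ne'
    simp [prob, Classical.em, this]
  linarith

theorem prob_comp_equiv {Ω' : Type} [Finite Ω'] (e : Ω ≃ Ω') (E : Ω' → Prop) :
    prob (fun ω => E (e ω)) = prob E := by
  unfold prob
  rw [Nat.card_congr e, Nat.card_congr (e.subtypeEquiv (q := E) fun _ => Iff.rfl)]

/-- If a finite family of injections of `Ω` spreads every point `ω` in such a way that `E` has
probability at most `δ` along the orbit of `ω`, then `E` has probability at most `δ`. -/
theorem prob_le_of_resample [Nonempty Ω] {Γ : Type} [Finite Γ] [Nonempty Γ] (act : Γ → Ω → Ω)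
    (hact : ∀ γ, Function.Injective (act γ)) {E : Ω → Prop} {δ : ℝ}
    (h : ∀ ω, prob (fun γ => E (act γ ω)) ≤ δ) : prob E ≤ δ := by
  classical
  have := Fintype.ofFinite Ω
  have := Fintype.ofFinite Γ
  have hΓ : (0 : ℝ) < Fintype.card Γ := by exact_mod_cast Fintype.card_pos
  have hΩ' : (0 : ℝ) < Fintype.card Ω := by exact_mod_cast Fintype.card_pos
  simp only [prob, Nat.card_eq_fintype_card, Fintype.card_subtype] at h ⊢
  rw [div_le_iff₀ hΩ']
  -- Double counting of the pairs `(γ, ω)`: each `act γ` permutes the finite set `Ω`, so the inner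
  -- sum does not depend on `γ`.
  have key : ∑ γ : Γ, ∑ ω : Ω, (if E (act γ ω) then (1 : ℝ) else 0) =
      Fintype.card Γ * (Finset.univ.filter E).card := by
    have : ∀ γ : Γ, ∑ ω : Ω, (if E (act γ ω) then (1 : ℝ) else 0) =
        (Finset.univ.filter E).card := fun γ => by
      rw [(Finite.injective_iff_bijective.mp (hact γ)).sum_comp
        (fun ω => if E ω then (1 : ℝ) else 0)]
      simp
    simp [this]
  rw [Finset.sum_comm] at key
  have h2 : ∑ ω : Ω, ∑ γ : Γ, (if E (act γ ω) then (1 : ℝ) else 0) ≤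
      ∑ ω : Ω, δ * Fintype.card Γ := by
    refine Finset.sum_le_sum fun ω _ => ?_
    have := h ω
    rw [div_le_iff₀ hΓ] at this
    simpa using this
  rw [key] at h2
  simp only [Finset.sum_const, Finset.card_univ, nsmul_eq_mul] at h2
  have : (Fintype.card Γ : ℝ) * (Finset.univ.filter E).card ≤
      Fintype.card Γ * (δ * Fintype.card Ω) := by linarith
  exact le_of_mul_le_mul_left this hΓ

end Probability

/-! ### Random points of a finite vector space -/

theorem prob_eval_eq_zero_le {F : Type} [Field F] [Fintype F] {τ : Type} [Fintype τ]
    {p : MvPolynomial τ F} (hp : p ≠ 0) {d : ℕ} (hd : p.totalDegree ≤ d) :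
    prob (fun x : τ → F => MvPolynomial.eval x p = 0) ≤ d / Fintype.card F := by
  classical
  let e := Fintype.equivFin τ
  have hp' : MvPolynomial.rename e p ≠ 0 := fun h =>
    hp (MvPolynomial.rename_injective e e.injective (by simpa using h))
  have key := MvPolynomial.schwartz_zippel_totalDegree hp' Finset.univ
  have hdeg : (MvPolynomial.rename e p).totalDegree ≤ d :=
    (MvPolynomial.totalDegree_rename_le _ _).trans hd
  rw [← prob_comp_equiv (Equiv.arrowCongr e.symm (Equiv.refl F))]
  have h1 : prob (fun x : Fin (Fintype.card τ) → F =>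
      MvPolynomial.eval (Equiv.arrowCongr e.symm (Equiv.refl F) x) p = 0) =
      (((Finset.filter (fun f => MvPolynomial.eval f (MvPolynomial.rename e p) = 0)
        (Fintype.piFinset fun _ => (Finset.univ : Finset F))).card /
        ((Finset.univ : Finset F).card : ℚ≥0) ^ Fintype.card τ : ℚ≥0) : ℝ) := by
    simp only [prob, Nat.card_eq_fintype_card, Fintype.card_subtype]
    push_cast
    simp only [Fintype.piFinset_univ, Fintype.card_fun, Fintype.card_fin, Finset.card_univ,
      MvPolynomial.eval_rename]
    push_cast
    rfl
  rw [h1]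
  calc _ ≤ (((MvPolynomial.rename e p).totalDegree / (Finset.univ : Finset F).card : ℚ≥0) : ℝ) := by
        exact_mod_cast key
    _ ≤ _ := by
        push_cast
        rw [Finset.card_univ]
        gcongr

/-- If `ev v` are surjective additive maps, compatible with scalars in `v`, then with high
probability no `ev v ω`, `v ≠ 0`, falls into a small subspace. -/
theorem prob_exists_mem_le {F : Type} [Field F] [Fintype F] {Ω V U : Type} [AddCommGroup Ω]
    [Finite Ω] [AddCommGroup V] [Module F V] [Finite V] [AddCommGroup U] [Module F U] [Finite U]
    (ev : V → Ω →+ U) (hsurj : ∀ v, v ≠ 0 → Function.Surjective (ev v))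
    (hsmul : ∀ (a : F) v ω, ev (a • v) ω = a • ev v ω) (S : Submodule F U)
    (hS : Nat.card S * Nat.card V ≤ Nat.card U) :
    prob (fun ω => ∃ v, v ≠ 0 ∧ ev v ω ∈ S) ≤ 1 / (Fintype.card F - 1) := by
  classical
  have := Fintype.ofFinite Ω
  have := Fintype.ofFinite V
  have := Fintype.ofFinite U
  have hq : 1 < Fintype.card F := Fintype.one_lt_card
  have hq' : (0 : ℝ) < Fintype.card F - 1 := by
    rw [sub_pos]; exact_mod_cast hq
  have hΩ : (0 : ℝ) < Fintype.card Ω := by exact_mod_cast Fintype.card_pos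
  have hU : (0 : ℝ) < Fintype.card U := by exact_mod_cast Fintype.card_pos
  simp only [Nat.card_eq_fintype_card] at hS
  -- The fibres of a surjective homomorphism have equal size, so `ev v ω` is uniform on `U`.
  have hfib : ∀ v, v ≠ 0 → (Finset.univ.filter fun ω => ev v ω ∈ S).card * Fintype.card U =
      Fintype.card S * Fintype.card Ω := by
    intro v hv
    have hfc : ∀ u : U, (Finset.univ.filter fun ω => ev v ω = u).card =
        (Finset.univ.filter fun ω => ev v ω = 0).card := fun u =>
      AddMonoidHom.card_fiber_eq_of_mem_range (ev v) (hsurj v hv u) (hsurj v hv 0)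
    have h1 : (Finset.univ.filter fun ω => ev v ω ∈ S).card =
        Fintype.card S * (Finset.univ.filter fun ω => ev v ω = 0).card := by
      rw [Finset.card_eq_sum_card_fiberwise (f := ev v) (t := Finset.univ.filter (· ∈ S))
        (by intro x; simp)]
      rw [Finset.sum_congr rfl (g := fun _ => (Finset.univ.filter fun ω => ev v ω = 0).card)]
      · simp [Fintype.card_subtype]
      · intro u hu
        rw [← hfc u, Finset.filter_filter]
        congr 1
        ext ω
        simp only [Finset.mem_filter, Finset.mem_univ, true_and] at hu ⊢
        constructor
        · exact fun h => h.2
        · intro h; exact ⟨h ▸ hu, h⟩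
    have h2 : Fintype.card Ω =
        Fintype.card U * (Finset.univ.filter fun ω => ev v ω = 0).card := by
      rw [← Finset.card_univ, Finset.card_eq_sum_card_fiberwise (f := ev v) (t := Finset.univ)
        (by intro x; simp)]
      simp [hfc]
    rw [h1, h2]; ring
  set Bad := Finset.univ.filter fun ω => ∃ v, v ≠ 0 ∧ ev v ω ∈ S with hBad
  -- A bad `ω` is bad for all `q - 1` nonzero multiples of `v`. As the expected number of bad `v` is
  -- at most `1`, this gains the factor `1 / (q - 1)` without any slack in `hS`.
  have hlow : Bad.card * (Fintype.card F - 1) ≤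
      ∑ ω : Ω, (Finset.univ.filter fun v => v ≠ 0 ∧ ev v ω ∈ S).card := by
    calc Bad.card * (Fintype.card F - 1) = ∑ ω ∈ Bad, (Fintype.card F - 1) := by simp
      _ ≤ ∑ ω ∈ Bad, (Finset.univ.filter fun v => v ≠ 0 ∧ ev v ω ∈ S).card := by
        refine Finset.sum_le_sum fun ω hω => ?_
        obtain ⟨v, hv, hvS⟩ := (Finset.mem_filter.mp hω).2
        rw [← Fintype.card_units, ← Finset.card_univ]
        refine Finset.card_le_card_of_injOn (fun a : Fˣ => (a : F) • v) ?_ ?_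
        · intro a _
          simp only [Finset.coe_filter, Finset.mem_univ, true_and, Set.mem_ofPred_eq, hsmul]
          exact ⟨smul_ne_zero a.ne_zero hv, S.smul_mem _ hvS⟩
        · intro a _ a' _ haa
          exact Units.ext (smul_left_injective F hv haa)
      _ ≤ _ := Finset.sum_le_sum_of_subset (Finset.subset_univ _)
  have hup : (∑ ω : Ω, (Finset.univ.filter fun v => v ≠ 0 ∧ ev v ω ∈ S).card) * Fintype.card U ≤
      Fintype.card V * Fintype.card S * Fintype.card Ω := by
    have hsw : ∑ ω : Ω, (Finset.univ.filter fun v => v ≠ 0 ∧ ev v ω ∈ S).card =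
        ∑ v ∈ Finset.univ.filter (fun v : V => v ≠ 0),
          (Finset.univ.filter fun ω => ev v ω ∈ S).card := by
      simp only [Finset.card_filter, Finset.sum_filter]
      rw [Finset.sum_comm]
      refine Finset.sum_congr rfl fun v _ => ?_
      by_cases hv : v = 0 <;> simp [hv]
    rw [hsw, Finset.sum_mul, Finset.sum_congr rfl fun v hv => hfib v (Finset.mem_filter.mp hv).2]
    rw [Finset.sum_const, smul_eq_mul, mul_assoc]
    gcongr
    exact Finset.card_le_univ _
  have hfinal : Bad.card * (Fintype.card F - 1) ≤ Fintype.card Ω := by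
    have h3 : Bad.card * (Fintype.card F - 1) * Fintype.card U ≤
        Fintype.card Ω * Fintype.card U := by
      calc _ ≤ _ := Nat.mul_le_mul_right _ hlow
        _ ≤ _ := hup
        _ ≤ _ := by
          rw [mul_comm (Fintype.card V), mul_comm (Fintype.card Ω)]
          exact Nat.mul_le_mul_right _ hS
    exact Nat.le_of_mul_le_mul_right h3 Fintype.card_pos
  simp only [prob, Nat.card_eq_fintype_card, Fintype.card_subtype]
  rw [div_le_div_iff₀ hΩ hq', one_mul]
  have : ((Fintype.card F - 1 : ℕ) : ℝ) = Fintype.card F - 1 := by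
    push_cast [hq.le]; rfl
  rw [← this]
  exact_mod_cast hfinal

/-! ### Ranks of matrices -/

section Rank

variable {F : Type} [Field F]

theorem Matrix.rank_add_le' {m n : Type} [Fintype m] [Fintype n] (A B : Matrix m n F) :
    (A + B).rank ≤ A.rank + B.rank := by
  rw [Matrix.rank, Matrix.rank, Matrix.rank, Matrix.mulVecLin_add]
  calc _ ≤ Module.finrank F ↥(LinearMap.range A.mulVecLin ⊔ LinearMap.range B.mulVecLin) :=
        Submodule.finrank_mono (by
          rintro _ ⟨v, rfl⟩
          exact Submodule.add_mem_sup ⟨v, rfl⟩ ⟨v, rfl⟩)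
    _ ≤ _ := Submodule.finrank_add_le_finrank_add_finrank _ _

theorem Matrix.rank_sum_le {m n ι : Type} [Fintype m] [Fintype n] (s : Finset ι)
    (A : ι → Matrix m n F) : (∑ j ∈ s, A j).rank ≤ ∑ j ∈ s, (A j).rank := by
  classical
  induction s using Finset.induction_on with
  | empty => simp
  | insert a s ha ih =>
    rw [Finset.sum_insert ha, Finset.sum_insert ha]
    exact (Matrix.rank_add_le' _ _).trans (by gcongr)

theorem Matrix.rank_add_nullity {m n : Type} [Fintype m] [Fintype n] (A : Matrix m n F) :
    A.rank + Module.finrank F (LinearMap.ker A.mulVecLin) = Fintype.card n := by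
  rw [Matrix.rank, LinearMap.finrank_range_add_finrank_ker, Module.finrank_fintype_fun_eq_card]

/-- The easy half of König's theorem: the rows outside `R` and the columns outside `K` cover all
nonzero entries. -/
theorem Matrix.rank_le_of_zero_block {m n : Type} [Fintype m] [Fintype n] [DecidableEq m]
    [DecidableEq n] (A : Matrix m n F) (R : Finset m) (K : Finset n)
    (h : ∀ x ∈ R, ∀ y ∈ K, A x y = 0) : A.rank ≤ Rᶜ.card + Kᶜ.card := by
  have hA : A = (Matrix.of fun x y => if x ∈ R then 0 else A x y) +
      Matrix.of fun x y => if x ∈ R then A x y else 0 := by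
    ext x y
    by_cases hx : x ∈ R <;> simp [hx]
  rw [hA]
  refine (Matrix.rank_add_le' _ _).trans (add_le_add ?_ ?_)
  · refine Matrix.rank_le_card_of_support_subset _ _ ?_
    intro x hx
    simp only [Finset.coe_compl, Set.mem_compl_iff, Finset.mem_coe]
    intro hxR
    exact hx (by ext y; simp [hxR])
  · rw [← Matrix.rank_transpose]
    refine Matrix.rank_le_card_of_support_subset _ _ ?_
    intro y hy
    simp only [Finset.coe_compl, Set.mem_compl_iff, Finset.mem_coe]
    intro hyK
    refine hy ?_
    ext x
    by_cases hx : x ∈ R <;> simp [hx]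
    exact h x hx y hyK

/-- Extension of a vector by zero. -/
def extendZero {E : Type} (p : E → Prop) [DecidablePred p] : ({e // p e} → F) →ₗ[F] (E → F) where
  toFun x e := if h : p e then x ⟨e, h⟩ else 0
  map_add' x y := by ext e; by_cases h : p e <;> simp [h]
  map_smul' c x := by ext e; by_cases h : p e <;> simp [h]

theorem extendZero_apply {E : Type} (p : E → Prop) [DecidablePred p] (x : {e // p e} → F) (e : E) :
    extendZero p x e = if h : p e then x ⟨e, h⟩ else 0 := rfl

theorem mulVec_extendZero {m E : Type} [Fintype E] (p : E → Prop) [DecidablePred p]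
    (A : Matrix m E F) (x : {e // p e} → F) :
    A *ᵥ extendZero p x = A.submatrix id Subtype.val *ᵥ x := by
  ext i
  simp only [Matrix.mulVec, dotProduct, Matrix.submatrix_apply, id]
  rw [← Fintype.sum_subtype_add_sum_subtype p]
  have h2 : ∑ e : {e // ¬ p e}, A i e * extendZero p x e = 0 :=
    Finset.sum_eq_zero fun e _ => by rw [extendZero_apply, dif_neg e.2, mul_zero]
  rw [h2, add_zero]
  exact Finset.sum_congr rfl fun e _ => by rw [extendZero_apply, dif_pos e.2]

/-- Complementary blocks of a matrix and of its inverse: comparison of the kernels. -/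
theorem Matrix.nullity_submatrix_le {E : Type} [Fintype E] [DecidableEq E] {A : Matrix E E F}
    (hA : IsUnit A.det) {p p' r r' : E → Prop} [DecidablePred p] [DecidablePred p']
    [DecidablePred r] [DecidablePred r'] (hp : ∀ e, p' e ↔ ¬ p e) (hr : ∀ e, r' e ↔ ¬ r e) :
    Module.finrank F (LinearMap.ker (A.submatrix (Subtype.val : {e // r' e} → E)
      (Subtype.val : {e // p' e} → E)).mulVecLin) ≤
    Module.finrank F (LinearMap.ker (A⁻¹.submatrix (Subtype.val : {e // p e} → E)
      (Subtype.val : {e // r e} → E)).mulVecLin) := by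
  -- If `x`, supported on `p'`, is killed by the rows in `r'`, then `A x` is supported on `r`, and
  -- `A⁻¹` returns it to `x`, which vanishes on `p`. So `x ↦ A x` embeds one kernel into the other.
  let Φ : ({e // p' e} → F) →ₗ[F] ({e // r e} → F) :=
    LinearMap.funLeft F F Subtype.val ∘ₗ A.mulVecLin ∘ₗ extendZero p'
  have hΦ : ∀ x, (A.submatrix (Subtype.val : {e // r' e} → E)
      (Subtype.val : {e // p' e} → E)) *ᵥ x = 0 →
      extendZero r (Φ x) = A *ᵥ extendZero p' x := by
    intro x hx
    ext e
    by_cases he : r e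
    · rw [extendZero_apply, dif_pos he]; rfl
    · rw [extendZero_apply, dif_neg he, mulVec_extendZero]
      exact (congrFun hx ⟨e, (hr e).2 he⟩).symm
  have hinv : ∀ v : E → F, A⁻¹ *ᵥ (A *ᵥ v) = v := fun v => by
    rw [Matrix.mulVec_mulVec, Matrix.nonsing_inv_mul A hA, Matrix.one_mulVec]
  have hmem : ∀ x ∈ LinearMap.ker (A.submatrix (Subtype.val : {e // r' e} → E)
      (Subtype.val : {e // p' e} → E)).mulVecLin,
      Φ x ∈ LinearMap.ker (A⁻¹.submatrix (Subtype.val : {e // p e} → E)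
      (Subtype.val : {e // r e} → E)).mulVecLin := by
    intro x hx
    rw [LinearMap.mem_ker, Matrix.mulVecLin_apply] at hx ⊢
    have h1 := mulVec_extendZero r A⁻¹ (Φ x)
    rw [hΦ x hx, hinv] at h1
    ext e
    have := congrFun h1 e.1
    rw [extendZero_apply, dif_neg (fun h => (hp e.1).1 h e.2)] at this
    exact this.symm
  refine LinearMap.finrank_le_finrank_of_injective (f := Φ.restrict hmem) ?_
  rw [← LinearMap.ker_eq_bot, LinearMap.ker_eq_bot']
  rintro ⟨x, hx⟩ h0
  have h1 : Φ x = 0 := congrArg Subtype.val h0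
  have h2 := hΦ x (by simpa using hx)
  rw [h1, map_zero] at h2
  have h3 := hinv (extendZero p' x)
  rw [← h2, Matrix.mulVec_zero] at h3
  ext e
  have := congrFun h3 e.1
  rw [extendZero_apply, dif_pos e.2] at this
  exact this.symm

/-- The rank of a block of an inverse matrix. -/
theorem Matrix.rank_submatrix_inv {E : Type} [Fintype E] [DecidableEq E] {A : Matrix E E F}
    (hA : IsUnit A.det) (p r : E → Prop) [DecidablePred p] [DecidablePred r] :
    (A⁻¹.submatrix (Subtype.val : {e // p e} → E) (Subtype.val : {e // r e} → E)).rank +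
      Fintype.card {e // ¬ p e} = Fintype.card {e // r e} +
      (A.submatrix (Subtype.val : {e // ¬ r e} → E) (Subtype.val : {e // ¬ p e} → E)).rank := by
  -- The inequality is used for `A` and for `A⁻¹`, so the two nullities agree; rank-nullity converts
  -- them into ranks.
  have h1 := Matrix.nullity_submatrix_le hA (p := p) (r := r) (fun e => Iff.rfl) (fun e => Iff.rfl)
  have hA' : IsUnit A⁻¹.det := by rwa [Matrix.isUnit_nonsing_inv_det_iff]
  have h2 := Matrix.nullity_submatrix_le hA' (p := fun e => ¬ r e) (p' := r) (r := fun e => ¬ p e)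
    (r' := p) (fun e => not_not.symm) (fun e => not_not.symm)
  rw [Matrix.nonsing_inv_nonsing_inv A hA] at h2
  have h3 := Matrix.rank_add_nullity
    (A⁻¹.submatrix (Subtype.val : {e // p e} → E) (Subtype.val : {e // r e} → E))
  have h4 := Matrix.rank_add_nullity
    (A.submatrix (Subtype.val : {e // ¬ r e} → E) (Subtype.val : {e // ¬ p e} → E))
  omega

end Rank

namespace Network

/-! ### The combinatorics of the cuts -/

theorem errorCut_le (N : Network) (C : Finset (Fin N.edges)) {S : Finset (Fin N.nodes)}
    (hS : N.sink ∉ S) : N.errorCut C ≤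
      (Finset.univ.filter fun e => (e ∈ C ∨ N.tail e ∈ S) ∧ ¬ N.heads e ⊆ S).card :=
  Nat.sInf_le ⟨S, hS, rfl⟩

theorem exists_errorCut_eq (N : Network) (C : Finset (Fin N.edges)) :
    ∃ S : Finset (Fin N.nodes), N.sink ∉ S ∧ N.errorCut C =
      (Finset.univ.filter fun e => (e ∈ C ∨ N.tail e ∈ S) ∧ ¬ N.heads e ⊆ S).card :=
  Nat.sInf_mem (s := {k | ∃ S : Finset (Fin N.nodes), N.sink ∉ S ∧
    k = (Finset.univ.filter fun e => (e ∈ C ∨ N.tail e ∈ S) ∧ ¬ N.heads e ⊆ S).card})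
    ⟨_, ∅, by simp, rfl⟩

theorem capacity_le (N : Network) {S : Finset (Fin N.nodes)} (hS : N.source ∈ S)
    (hS' : N.sink ∉ S) : N.capacity ≤
      (Finset.univ.filter fun e => N.tail e ∈ S ∧ ¬ N.heads e ⊆ S).card :=
  Nat.sInf_le ⟨S, hS, hS', rfl⟩

theorem capacity_le_card_out (N : Network) : N.capacity ≤ Fintype.card N.Out := by
  refine (N.capacity_le (S := {N.source}) (by simp)
    (by simpa using N.source_ne_sink.symm)).trans ?_
  rw [Fintype.card_subtype]
  refine Finset.card_le_card fun e he => ?_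
  simp only [Finset.mem_filter, Finset.mem_singleton] at he ⊢
  exact ⟨he.1, he.2.1⟩

/-- The hyperedges leaving Alice. -/
def outEdges (N : Network) : Finset (Fin N.edges) :=
  Finset.univ.filter fun e => N.tail e = N.source

/-- Her outgoing hyperedges are counted already, so Alice can be added to the cut set at no cost. -/
theorem capacity_le_errorCut_outEdges (N : Network) : N.capacity ≤ N.errorCut N.outEdges := by
  obtain ⟨S, hS, h⟩ := N.exists_errorCut_eq N.outEdges
  rw [h]
  refine (N.capacity_le (S := insert N.source S) (by simp)
    (by simp [hS, N.source_ne_sink.symm])).trans ?_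
  · refine Finset.card_le_card fun e he => ?_
    simp only [Finset.mem_filter, Finset.mem_univ, true_and, Finset.mem_insert, outEdges] at he ⊢
    exact ⟨he.1, fun h => he.2 (h.trans (Finset.subset_insert _ _))⟩

/-- The cut formula in terms of sets of hyperedges, none of which is fed by one of the others. -/
theorem errorCut_add_card_le (N : Network) (C R K : Finset (Fin N.edges)) (hR : ∀ e ∈ R, e ∉ C)
    (hK : ∀ e ∈ K, N.sink ∉ N.heads e)
    (hRK : ∀ e ∈ R, ∀ e' ∈ K, e ≠ e' ∧ N.tail e ∉ N.heads e') :
    N.errorCut C + R.card + K.card ≤ N.edges := by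
  -- The cut is taken at the set of nodes reached by `K`. Hyperedges of `K` end inside it, those of
  -- `R` start outside it, so neither are counted by the cut.
  have hS : N.sink ∉ K.biUnion N.heads := by
    simpa using hK
  have h1 := N.errorCut_le C hS
  have hdisj : Disjoint R K := Finset.disjoint_left.2 fun e he he' => (hRK e he e he').1 rfl
  have hdisj' : Disjoint (Finset.univ.filter fun e => (e ∈ C ∨ N.tail e ∈ K.biUnion N.heads) ∧
      ¬ N.heads e ⊆ K.biUnion N.heads) (R ∪ K) := by
    refine Finset.disjoint_left.2 fun e he he' => ?_
    obtain ⟨h2, h3⟩ := (Finset.mem_filter.1 he).2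
    rcases Finset.mem_union.1 he' with h | h
    · rcases h2 with h2 | h2
      · exact hR e h h2
      · obtain ⟨e', he', h4⟩ := Finset.mem_biUnion.1 h2
        exact (hRK e h e' he').2 h4
    · exact h3 (Finset.subset_biUnion_of_mem N.heads h)
  have h5 := Finset.card_le_univ ((Finset.univ.filter fun e =>
    (e ∈ C ∨ N.tail e ∈ K.biUnion N.heads) ∧ ¬ N.heads e ⊆ K.biUnion N.heads) ∪ (R ∪ K))
  rw [Finset.card_union_of_disjoint hdisj', Finset.card_union_of_disjoint hdisj,
    Fintype.card_fin] at h5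
  omega

theorem card_subtype_not_add (N : Network) (p : Fin N.edges → Prop) [DecidablePred p] :
    Fintype.card {e // p e} + Fintype.card {e // ¬ p e} = N.edges := by
  have h := Fintype.card_subtype_compl p
  have h2 := Fintype.card_subtype_le p
  rw [Fintype.card_fin] at h h2
  omega

/-- A system of disjoint paths, encoded as a matching between hyperedges. -/
theorem exists_matching (N : Network) (C : Finset (Fin N.edges)) :
    ∃ (R : Finset (Fin N.edges)) (g : {e // e ∈ R} → Fin N.edges), Function.Injective g ∧
      (∀ e ∈ R, e ∉ C) ∧
      (∀ e, N.sink ∉ N.heads (g e) ∧ (e.1 = g e ∨ N.tail e.1 ∈ N.heads (g e))) ∧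
      N.errorCut C + Fintype.card {e // e ∉ C} ≤ R.card + Fintype.card N.In := by
  classical
  have hIn : Fintype.card N.In + Fintype.card {e // N.sink ∉ N.heads e} = N.edges :=
    N.card_subtype_not_add fun e => N.sink ∈ N.heads e
  have hz : N.errorCut C + Fintype.card {e // N.sink ∉ N.heads e} ≤ N.edges := by
    have := N.errorCut_add_card_le C ∅ (Finset.univ.filter fun e => N.sink ∉ N.heads e)
      (by simp) (by simp) (by simp)
    rwa [Finset.card_empty, add_zero, ← Fintype.card_subtype] at this
  -- Hall's theorem with deficiency: `d` dummy partners, available to everybody, make a complete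
  -- matching possible.
  obtain ⟨d, hd⟩ : ∃ d, N.errorCut C + d = Fintype.card N.In :=
    ⟨Fintype.card N.In - N.errorCut C, by omega⟩
  let nb : {e // e ∉ C} → Finset (Fin N.edges) := fun e =>
    Finset.univ.filter fun e' => N.sink ∉ N.heads e' ∧ (e.1 = e' ∨ N.tail e.1 ∈ N.heads e')
  let t : {e // e ∉ C} → Finset (Fin N.edges ⊕ Fin d) := fun e =>
    (nb e).disjSum Finset.univ
  have hall : ∀ s : Finset {e // e ∉ C}, s.card ≤ (s.biUnion t).card := by
    intro s
    rcases s.eq_empty_or_nonempty with rfl | hs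
    · simp
    have h1 : s.biUnion t = (s.biUnion nb).disjSum Finset.univ := by
      ext x
      rcases x with x | x
      · simp [t]
      · obtain ⟨e, he⟩ := hs
        simpa [t] using ⟨e.1, e.2, he⟩
    rw [h1, Finset.card_disjSum, Finset.card_univ, Fintype.card_fin]
    -- Hall's condition is the cut bound for `s` and all hyperedges that miss Bob and are not
    -- neighbours of `s`.
    have h2 := N.errorCut_add_card_le C (s.map (Function.Embedding.subtype _))
      ((Finset.univ.filter fun e => N.sink ∉ N.heads e) \ s.biUnion nb)
      (fun e he => by
        obtain ⟨e, -, rfl⟩ := Finset.mem_map.1 he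
        exact e.2) (by simp +contextual) (by
        intro e he e' he'
        simp only [Finset.mem_map, Function.Embedding.coe_subtype] at he
        obtain ⟨e, he, rfl⟩ := he
        simp only [Finset.mem_sdiff, Finset.mem_filter, Finset.mem_univ, true_and,
          Finset.mem_biUnion, not_exists, not_and] at he'
        have := he'.2 e he
        simp only [nb, Finset.mem_filter, Finset.mem_univ, true_and, not_and, not_or] at this
        exact this he'.1)
    have hsub : s.biUnion nb ⊆ Finset.univ.filter fun e => N.sink ∉ N.heads e := by
      intro e he
      simp only [nb, Finset.mem_biUnion, Finset.mem_filter, Finset.mem_univ, true_and] at he ⊢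
      obtain ⟨a, -, h, -⟩ := he
      exact h
    have hle := Finset.card_le_card hsub
    rw [Finset.card_map, Finset.card_sdiff_of_subset hsub] at h2
    rw [← Fintype.card_subtype] at h2 hle
    omega
  obtain ⟨f, hf, hft⟩ := (Finset.all_card_le_biUnion_card_iff_exists_injective t).1 hall
  -- Only the hyperedges with a genuine partner are kept; at most `d` are lost to the dummies.
  let R : Finset (Fin N.edges) := Finset.univ.filter fun e => ∃ (h : e ∉ C) (e' : Fin N.edges),
    f ⟨e, h⟩ = Sum.inl e'
  have hRmem : ∀ e : {e // e ∈ R}, ∃ (h : e.1 ∉ C) (e' : Fin N.edges), f ⟨e.1, h⟩ = Sum.inl e' :=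
    fun e => (Finset.mem_filter.1 e.2).2
  choose hC g hg using hRmem
  refine ⟨R, g, ?_, fun e he => hC ⟨e, he⟩, ?_, ?_⟩
  · intro e e' h
    have : f ⟨e.1, hC e⟩ = f ⟨e'.1, hC e'⟩ := by rw [hg, hg, h]
    exact Subtype.ext (congrArg (fun x => x.1) (hf this))
  · intro e
    have := hft ⟨e.1, hC e⟩
    rw [hg] at this
    simpa [t, nb] using this
  · have h3 : Fintype.card {e // e ∉ C} ≤ R.card + d := by
      have : Fintype.card {e // e ∉ C} ≤ Fintype.card ({e // e ∈ R} ⊕ Fin d) := by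
        have hex : ∀ e : {e // e ∉ C}, ∃ y : {e // e ∈ R} ⊕ Fin d,
            (∃ h, y = Sum.inl ⟨e.1, h⟩) ∨ ∃ x, y = Sum.inr x ∧ f e = Sum.inr x := by
          intro e
          rcases h : f e with e' | x
          · exact ⟨Sum.inl ⟨e.1, Finset.mem_filter.2 ⟨Finset.mem_univ _, e.2, e', h⟩⟩,
              Or.inl ⟨_, rfl⟩⟩
          · exact ⟨Sum.inr x, Or.inr ⟨x, rfl, rfl⟩⟩
        choose φ hφ using hex
        refine Fintype.card_le_of_injective φ fun e e' h => ?_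
        rcases hφ e with ⟨h1, h2⟩ | ⟨x, h1, h2⟩ <;> rcases hφ e' with ⟨h1', h2'⟩ | ⟨x', h1', h2'⟩
        · rw [h2, h2', Sum.inl.injEq, Subtype.mk.injEq] at h
          exact Subtype.ext h
        · simp [h2, h1'] at h
        · simp [h1, h2'] at h
        · rw [h1, h1', Sum.inr.injEq] at h
          exact hf (by rw [h2, h2', h])
      simpa using this
    omega

end Network

namespace Network

/-! ### The ranks of the transfer matrices -/

section Transfer

variable {F : Type} [Field F]

/-- This removes the inverse: what remains is the complementary block of `1 - mixing`, whose zero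
pattern is read off from the network. -/
theorem rank_transferQ_add (N : Network) {a : Matrix (Fin N.edges) (Fin N.edges) F}
    (hA : IsUnit (1 - N.mixing a).det) (C : Finset (Fin N.edges)) :
    (N.transferQ a C).rank + Fintype.card {e // N.sink ∉ N.heads e} =
      C.card + ((1 - N.mixing a).submatrix
        (Subtype.val : {e // e ∉ C} → Fin N.edges)
        (Subtype.val : {e // N.sink ∉ N.heads e} → Fin N.edges)).rank := by
  have h := Matrix.rank_submatrix_inv hA (fun e => N.sink ∈ N.heads e) (fun e => e ∈ C)
  rw [← Fintype.card_coe C]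
  convert h
  rfl

/-- A minimal cut produces a large zero block in `1 - mixing`. No genericity is involved, so the
bound is available for every choice of coefficients. -/
theorem rank_transferQ_le (N : Network) (a : Matrix (Fin N.edges) (Fin N.edges) F)
    (C : Finset (Fin N.edges)) : (N.transferQ a C).rank ≤ N.errorCut C := by
  classical
  by_cases hA : IsUnit (1 - N.mixing a).det
  swap
  -- If `1 - mixing` is singular, `⁻¹` takes the default value `0`.
  · have : N.transferQ a C = 0 := by
      ext x y
      simp [transferQ, global, Matrix.nonsing_inv_apply_not_isUnit _ hA]
    rw [this, Matrix.rank_zero]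
    exact Nat.zero_le _
  obtain ⟨S, hS, hcut⟩ := N.exists_errorCut_eq C
  have hrank := N.rank_transferQ_add hA C
  have hzero := Matrix.rank_le_of_zero_block ((1 - N.mixing a).submatrix
    (Subtype.val : {e // e ∉ C} → Fin N.edges)
    (Subtype.val : {e // N.sink ∉ N.heads e} → Fin N.edges))
    (Finset.univ.filter fun e => N.tail e.1 ∉ S ∧ ¬ N.heads e.1 ⊆ S)
    (Finset.univ.filter fun e => N.heads e.1 ⊆ S) (by
      intro x hx y hy
      simp only [Finset.mem_filter, Finset.mem_univ, true_and] at hx hy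
      have h1 : x.1 ≠ y.1 := fun h => hx.2 (h ▸ hy)
      have h2 : N.tail x.1 ∉ N.heads y.1 := fun h => hx.1 (hy h)
      simp [mixing, Matrix.one_apply_ne h1, h2])
  have hR : ((Finset.univ : Finset {e // e ∉ C}).filter
      fun e => N.tail e.1 ∉ S ∧ ¬ N.heads e.1 ⊆ S).card =
      (Finset.univ.filter fun e => e ∉ C ∧ N.tail e ∉ S ∧ ¬ N.heads e ⊆ S).card := by
    rw [← Finset.card_map (Function.Embedding.subtype _)]
    congr 1
    ext e
    simp
    tauto
  have hK : ((Finset.univ : Finset {e // N.sink ∉ N.heads e}).filter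
      fun e => N.heads e.1 ⊆ S).card = (Finset.univ.filter fun e => N.heads e ⊆ S).card := by
    rw [← Finset.card_map (Function.Embedding.subtype _)]
    congr 1
    ext e
    simp only [Finset.mem_map, Finset.mem_filter, Finset.mem_univ, true_and,
      Function.Embedding.subtype_apply, Subtype.exists, exists_and_left, exists_prop,
      exists_eq_right_right, and_iff_left_iff_imp]
    exact fun h h' => hS (h h')
  -- Every hyperedge either crosses the cut, or indexes a row of the zero block, or indexes a column
  -- of it.
  have hpart : N.errorCut C +
      (Finset.univ.filter fun e => e ∉ C ∧ N.tail e ∉ S ∧ ¬ N.heads e ⊆ S).card +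
      (Finset.univ.filter fun e => N.heads e ⊆ S).card = N.edges := by
    rw [hcut, ← Finset.card_union_of_disjoint, ← Finset.card_union_of_disjoint]
    · refine Eq.trans ?_ (Finset.card_fin N.edges)
      congr 1
      ext e
      simp
      tauto
    · refine Finset.disjoint_left.2 fun e he he' => ?_
      simp at he he'
      tauto
    · refine Finset.disjoint_left.2 fun e he he' => ?_
      simp at he he'
      tauto
  have hC := N.card_subtype_not_add fun e => e ∈ C
  rw [Fintype.card_subtype, Finset.filter_univ_mem] at hC
  rw [Finset.card_compl, Finset.card_compl, hR, hK] at hzero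
  have hR' := Finset.card_le_univ ((Finset.univ : Finset {e // e ∉ C}).filter
      fun e => N.tail e.1 ∉ S ∧ ¬ N.heads e.1 ⊆ S)
  have hK' := Finset.card_le_univ ((Finset.univ : Finset {e // N.sink ∉ N.heads e}).filter
      fun e => N.heads e.1 ⊆ S)
  rw [hR] at hR'
  rw [hK] at hK'
  omega

/-- The matching `g` selects a square minor of the complementary block; if it does not vanish, that
block has rank at least `R.card`. -/
theorem le_rank_transferQ (N : Network) {a : Matrix (Fin N.edges) (Fin N.edges) F}
    (hA : (1 - N.mixing a).det ≠ 0) {C R : Finset (Fin N.edges)} {g : {e // e ∈ R} → Fin N.edges}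
    (hRC : ∀ e ∈ R, e ∉ C) (hg : ∀ e, N.sink ∉ N.heads (g e))
    (hcard : N.errorCut C + Fintype.card {e // e ∉ C} ≤ R.card + Fintype.card N.In)
    (hdet : ((1 - N.mixing a).submatrix Subtype.val g).det ≠ 0) :
    N.errorCut C ≤ (N.transferQ a C).rank := by
  have hrank := N.rank_transferQ_add hA.isUnit C
  have h1 := Matrix.rank_submatrix_le ((1 - N.mixing a).submatrix
    (Subtype.val : {e // e ∉ C} → Fin N.edges)
    (Subtype.val : {e // N.sink ∉ N.heads e} → Fin N.edges))
    (fun e : {e // e ∈ R} => (⟨e.1, hRC e.1 e.2⟩ : {e // e ∉ C}))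
    (fun e : {e // e ∈ R} => (⟨g e, hg e⟩ : {e // N.sink ∉ N.heads e}))
  have h2 := Matrix.rank_of_det_ne_zero hdet
  rw [Fintype.card_coe] at h2
  rw [Matrix.submatrix_submatrix] at h1
  have h3 : R.card ≤ ((1 - N.mixing a).submatrix
    (Subtype.val : {e // e ∉ C} → Fin N.edges)
    (Subtype.val : {e // N.sink ∉ N.heads e} → Fin N.edges)).rank := h2 ▸ h1
  have hC := N.card_subtype_not_add fun e => e ∈ C
  rw [Fintype.card_subtype, Finset.filter_univ_mem] at hC
  have hIn : Fintype.card N.In + Fintype.card {e // N.sink ∉ N.heads e} = N.edges :=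
    N.card_subtype_not_add fun e => N.sink ∈ N.heads e
  omega

/-- Alice acts like a Calvin who injects on all her hyperedges, so results on `transferQ` also cover
`transferT`. -/
theorem rank_transferQ_outEdges (N : Network) (a : Matrix (Fin N.edges) (Fin N.edges) F) :
    (N.transferQ a N.outEdges).rank = (N.transferT a).rank := by
  let e : {e // e ∈ N.outEdges} ≃ N.Out :=
    Equiv.subtypeEquivRight fun e => by simp [outEdges]
  exact Matrix.rank_submatrix (N.transferT a) (Equiv.refl _) e

end Transfer

/-! ### Generic coefficients -/

section Generic

variable (F : Type) [Field F]

/-- The matrix `1 - mixing` with indeterminate coefficients. -/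
def genericMatrix (N : Network) :
    Matrix (Fin N.edges) (Fin N.edges) (MvPolynomial (Fin N.edges × Fin N.edges) F) :=
  fun e e' => (if e = e' then 1 else 0) -
    if N.tail e ∈ N.heads e' then MvPolynomial.X (e, e') else 0

/-- The matrix of indeterminates with the support of `1 - mixing`. -/
def genericSupport (N : Network) :
    Matrix (Fin N.edges) (Fin N.edges) (MvPolynomial (Fin N.edges × Fin N.edges) F) :=
  fun e e' => if e = e' ∨ N.tail e ∈ N.heads e' then MvPolynomial.X (e, e') else 0

variable {F}

theorem totalDegree_det_le {τ ι : Type} [Fintype ι] [DecidableEq ι]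
    (M : Matrix ι ι (MvPolynomial τ F)) (h : ∀ x y, (M x y).totalDegree ≤ 1) :
    M.det.totalDegree ≤ Fintype.card ι := by
  rw [Matrix.det_apply]
  refine MvPolynomial.totalDegree_finsetSum_le fun s _ => ?_
  refine (MvPolynomial.totalDegree_smul_le _ _).trans ?_
  refine (MvPolynomial.totalDegree_finsetProd _ _).trans ?_
  refine (Finset.sum_le_card_nsmul _ _ 1 fun x _ => h _ _).trans ?_
  simp

theorem totalDegree_genericMatrix_le (N : Network) (e e' : Fin N.edges) :
    (N.genericMatrix F e e').totalDegree ≤ 1 := by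
  refine (MvPolynomial.totalDegree_sub _ _).trans (max_le ?_ ?_)
  · split_ifs <;> simp
  · split_ifs <;> simp

theorem totalDegree_genericSupport_le (N : Network) (e e' : Fin N.edges) :
    (N.genericSupport F e e').totalDegree ≤ 1 := by
  unfold genericSupport
  split_ifs <;> simp

theorem eval_genericMatrix (N : Network) (a : Fin N.edges × Fin N.edges → F) :
    (N.genericMatrix F).map (MvPolynomial.eval a) = 1 - N.mixing fun e e' => a (e, e') := by
  ext e e'
  simp only [genericMatrix, Matrix.map_apply, map_sub, Matrix.sub_apply, Matrix.one_apply, mixing]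
  split_ifs <;> simp

theorem eval_det_submatrix_genericMatrix (N : Network) {ι : Type} [Fintype ι] [DecidableEq ι]
    (f g : ι → Fin N.edges) (a : Fin N.edges × Fin N.edges → F) :
    MvPolynomial.eval a ((N.genericMatrix F).submatrix f g).det =
      ((1 - N.mixing fun e e' => a (e, e')).submatrix f g).det := by
  rw [← eval_genericMatrix, RingHom.map_det]
  rfl

theorem det_genericMatrix_ne_zero (N : Network) : (N.genericMatrix F).det ≠ 0 := by
  intro h
  have h1 := N.eval_det_submatrix_genericMatrix id id (0 : Fin N.edges × Fin N.edges → F)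
  have h2 : (1 - N.mixing fun e e' => (0 : Fin N.edges × Fin N.edges → F) (e, e')) = 1 := by
    ext e e'
    simp [mixing]
  rw [h2, Matrix.submatrix_id_id, h] at h1
  simp at h1

/-- The diagonal of `1 - mixing` is not free, so the matching cannot be substituted directly. The
determinant is first handled with independent diagonal entries; dividing each row by its diagonal
entry then restores the ones. -/
theorem det_genericMatrix_submatrix_ne_zero [Fintype F] (N : Network)
    (hF : 2 * N.edges < Fintype.card F) {R : Finset (Fin N.edges)}
    {g : {e // e ∈ R} → Fin N.edges} (hinj : Function.Injective g)
    (hg : ∀ e, e.1 = g e ∨ N.tail e.1 ∈ N.heads (g e)) :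
    ((N.genericMatrix F).submatrix (Subtype.val : {e // e ∈ R} → Fin N.edges) g).det ≠ 0 := by
  classical
  set M := (N.genericSupport F).submatrix (Subtype.val : {e // e ∈ R} → Fin N.edges) g with hM
  have heval : ∀ x : Fin N.edges × Fin N.edges → F, MvPolynomial.eval x M.det =
      (Matrix.of fun e e' : {e // e ∈ R} =>
        if e.1 = g e' ∨ N.tail e.1 ∈ N.heads (g e') then x (e.1, g e') else 0).det := by
    intro x
    rw [RingHom.map_det]
    congr 1
    ext e e'
    simp only [hM, genericSupport, RingHom.mapMatrix_apply, Matrix.map_apply,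
      Matrix.submatrix_apply, Matrix.of_apply]
    split_ifs <;> simp
  have h1 : M.det ≠ 0 := by
    intro h0
    -- The indicator of the matching specializes the minor to the identity matrix, `g` being
    -- injective.
    have h2 := heval fun p => if ∃ h : p.1 ∈ R, g ⟨p.1, h⟩ = p.2 then 1 else 0
    have h3 : (Matrix.of fun e e' : {e // e ∈ R} =>
        if e.1 = g e' ∨ N.tail e.1 ∈ N.heads (g e') then
          (if ∃ h : e.1 ∈ R, g ⟨e.1, h⟩ = g e' then (1 : F) else 0) else 0) = 1 := by
      ext e e'
      by_cases hee : e = e'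
      · subst hee
        simp [hg e]
      · have : ¬ ∃ h : e.1 ∈ R, g ⟨e.1, h⟩ = g e' := fun ⟨h, h'⟩ => hee (hinj h')
        simp only [Matrix.of_apply, this, Matrix.one_apply, hee]
        simp
    rw [h0, h3] at h2
    simp at h2
  have h2 : (∏ e : Fin N.edges, MvPolynomial.X (e, e) :
      MvPolynomial (Fin N.edges × Fin N.edges) F) ≠ 0 :=
    Finset.prod_ne_zero_iff.2 fun e _ => MvPolynomial.X_ne_zero _
  have hdeg : (M.det * ∏ e : Fin N.edges, MvPolynomial.X (e, e)).totalDegree ≤ 2 * N.edges := by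
    refine (MvPolynomial.totalDegree_mul _ _).trans ?_
    have h3 := totalDegree_det_le M fun x y => N.totalDegree_genericSupport_le _ _
    have h4 : (∏ e : Fin N.edges, MvPolynomial.X (e, e) :
        MvPolynomial (Fin N.edges × Fin N.edges) F).totalDegree ≤ N.edges := by
      refine (MvPolynomial.totalDegree_finsetProd _ _).trans ?_
      simp
    have h5 : Fintype.card {e // e ∈ R} ≤ N.edges := by
      simpa using Fintype.card_subtype_le fun e => e ∈ R
    omega
  obtain ⟨x, hx⟩ : ∃ x, MvPolynomial.eval x (M.det * ∏ e : Fin N.edges, MvPolynomial.X (e, e)) ≠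
      0 := by
    by_contra! hall
    have h3 := prob_eval_eq_zero_le (mul_ne_zero h1 h2) hdeg
    have h4 : prob (fun x : Fin N.edges × Fin N.edges → F => MvPolynomial.eval x
        (M.det * ∏ e : Fin N.edges, MvPolynomial.X (e, e)) = 0) = 1 := by
      simp [prob, hall]
    rw [h4, le_div_iff₀ (by exact_mod_cast Fintype.card_pos), one_mul] at h3
    exact absurd (by exact_mod_cast h3) hF.not_ge
  rw [map_mul, map_prod, mul_ne_zero_iff, Finset.prod_ne_zero_iff, heval] at hx
  obtain ⟨hx1, hx2⟩ := hx
  simp only [Finset.mem_univ, MvPolynomial.eval_X, true_implies] at hx2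
  intro h0
  -- The sign cancels the one in `1 - mixing`; the coefficient of a possible self-loop is set to
  -- `0`, leaving `1` on the diagonal.
  have h3 := N.eval_det_submatrix_genericMatrix Subtype.val g
    fun p => if p.1 = p.2 then 0 else -(x p / x (p.1, p.1))
  rw [h0, map_zero] at h3
  have h4 : ((1 - N.mixing fun e e' => if e = e' then 0 else -(x (e, e') / x (e, e))).submatrix
      (Subtype.val : {e // e ∈ R} → Fin N.edges) g) =
      Matrix.of fun e e' : {e // e ∈ R} => (x (e.1, e.1))⁻¹ * (Matrix.of fun e e' : {e // e ∈ R} =>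
        if e.1 = g e' ∨ N.tail e.1 ∈ N.heads (g e') then x (e.1, g e') else 0) e e' := by
    ext e e'
    simp only [Matrix.submatrix_apply, Matrix.sub_apply, Matrix.one_apply, mixing, Matrix.of_apply]
    by_cases h5 : e.1 = g e'
    · simp [← h5, hx2]
    · by_cases h6 : N.tail e.1 ∈ N.heads (g e')
      · simp [h5, h6]; ring
      · simp [h5, h6]
  simp only at h3
  rw [h4, Matrix.det_mul_column] at h3
  exact mul_ne_zero (Finset.prod_ne_zero_iff.2 fun e _ => inv_ne_zero (hx2 e.1)) hx1 h3.symm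

theorem prob_det_eq_zero_le [Fintype F] (N : Network) {ι : Type} [Fintype ι] [DecidableEq ι]
    (f g : ι → Fin N.edges) (hι : Fintype.card ι ≤ N.edges)
    (h : ((N.genericMatrix F).submatrix f g).det ≠ 0) :
    prob (fun a : Matrix (Fin N.edges) (Fin N.edges) F =>
      ((1 - N.mixing a).submatrix f g).det = 0) ≤ N.edges / Fintype.card F := by
  have hd := (totalDegree_det_le ((N.genericMatrix F).submatrix f g)
    fun x y => N.totalDegree_genericMatrix_le _ _).trans hι
  refine le_of_eq_of_le ?_ (prob_eval_eq_zero_le h hd)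
  rw [← prob_comp_equiv (Ω' := Matrix (Fin N.edges) (Fin N.edges) F)
    (Equiv.curry (Fin N.edges) (Fin N.edges) F)]
  congr 1
  ext a
  rw [eval_det_submatrix_genericMatrix]
  rfl

/-- With high probability, the rank of the transfer matrix from any set of hyperedges to Bob is the
min cut. -/
theorem prob_rank_transferQ_ne_le [Fintype F] (N : Network) :
    prob (fun a : Matrix (Fin N.edges) (Fin N.edges) F =>
      ¬ ∀ C, (N.transferQ a C).rank = N.errorCut C) ≤
      ((2 ^ N.edges + 2) * (N.edges + 1) : ℕ) / Fintype.card F := by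
  have hq : (0 : ℝ) < Fintype.card F := by exact_mod_cast Fintype.card_pos
  by_cases hF : 2 * N.edges < Fintype.card F
  swap
  -- For `q ≤ 2 * N.edges` the claimed bound is at least `1`; the constant was enlarged for this
  -- purpose.
  · refine (prob_le_one _).trans ?_
    rw [one_le_div hq]
    have : 2 * N.edges ≤ (2 ^ N.edges + 2) * (N.edges + 1) := by
      calc 2 * N.edges ≤ 2 * (N.edges + 1) := by omega
        _ ≤ _ := by gcongr; exact Nat.le_add_left _ _
    exact_mod_cast (not_lt.1 hF).trans this
  choose R g hinj hRC hg hcard using N.exists_matching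
  have h1 : prob (fun a : Matrix (Fin N.edges) (Fin N.edges) F => (1 - N.mixing a).det = 0) ≤
      N.edges / Fintype.card F := by
    have := N.prob_det_eq_zero_le (F := F) id id (by simp) N.det_genericMatrix_ne_zero
    simpa using this
  -- One minor for each of the `2 ^ N.edges` sets `C`.
  have h2 : prob (fun a : Matrix (Fin N.edges) (Fin N.edges) F =>
      ∃ C, ((1 - N.mixing a).submatrix Subtype.val (g C)).det = 0) ≤
      Fintype.card (Finset (Fin N.edges)) * (N.edges / Fintype.card F) := by
    refine prob_exists_le _ fun C => N.prob_det_eq_zero_le _ _ ?_ ?_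
    · simpa using Fintype.card_subtype_le fun e => e ∈ R C
    · exact N.det_genericMatrix_submatrix_ne_zero hF (hinj C) fun e => (hg C e).2
  have h3 := prob_mono (Ω := Matrix (Fin N.edges) (Fin N.edges) F)
    (E := fun a => ¬ ∀ C, (N.transferQ a C).rank = N.errorCut C)
    (E' := fun a => (1 - N.mixing a).det = 0 ∨
      ∃ C, ((1 - N.mixing a).submatrix Subtype.val (g C)).det = 0) (by
      intro a ha
      by_contra! h
      refine ha fun C => le_antisymm (N.rank_transferQ_le a C) ?_
      exact N.le_rank_transferQ h.1 (hRC C) (fun e => (hg C e).1) (hcard C) (h.2 C))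
  refine h3.trans ((prob_or_le _ _).trans ((add_le_add h1 h2).trans ?_))
  rw [Fintype.card_finset, Fintype.card_fin, ← mul_div_assoc, ← add_div]
  gcongr
  push_cast
  nlinarith [pow_pos (two_pos : (0 : ℝ) < 2) N.edges, (Nat.cast_nonneg N.edges : (0 : ℝ) ≤ _)]

end Generic

end Network

/-! ### Row spaces -/

section RowSpace

variable {F : Type} [Field F]

/-- The row space of a matrix. -/
def rowSpace {m n : Type} (Y : Matrix m n F) : Submodule F (n → F) :=
  Submodule.span F (Set.range Y.row)

theorem row_mem_rowSpace {m n : Type} (Y : Matrix m n F) (x : m) : Y x ∈ rowSpace Y :=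
  Submodule.subset_span ⟨x, rfl⟩

theorem mem_rowSpace_iff {m n : Type} [Fintype m] {Y : Matrix m n F} {v : n → F} :
    v ∈ rowSpace Y ↔ ∃ w, w ᵥ* Y = v := by
  rw [rowSpace, ← range_vecMulLinear]
  rfl

theorem exists_mul_eq_of_forall_mem_rowSpace {l m n : Type} [Fintype m] {Y : Matrix m n F}
    {X : Matrix l n F} (h : ∀ s, X s ∈ rowSpace Y) : ∃ A : Matrix l m F, A * Y = X := by
  choose A hA using fun s => mem_rowSpace_iff.1 (h s)
  exact ⟨A, by ext s t; exact congrFun (hA s) t⟩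

theorem mul_mem_rowSpace {l m n : Type} [Fintype m] (A : Matrix l m F) (Y : Matrix m n F)
    (s : l) : (A * Y) s ∈ rowSpace Y :=
  mem_rowSpace_iff.2 ⟨A s, rfl⟩

theorem Matrix.exists_mul_eq_one {m n : Type} [Fintype m] [DecidableEq m] [Fintype n]
    [DecidableEq n] {A : Matrix m n F} (h : ∀ v, A *ᵥ v = 0 → v = 0) :
    ∃ B : Matrix n m F, B * A = 1 := by
  obtain ⟨g, hg⟩ := A.mulVecLin.exists_leftInverse_of_injective (LinearMap.ker_eq_bot'.2 h)
  refine ⟨LinearMap.toMatrix' g, ?_⟩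
  have : LinearMap.toMatrix' A.mulVecLin = A := LinearMap.toMatrix'_toLin' A
  rw [← this, ← LinearMap.toMatrix'_comp, hg, LinearMap.toMatrix'_id]

end RowSpace

namespace Expansion

/-! ### The expansion of the received matrix -/

variable {F : Type} [Field F] {ρ α β : Type} [Fintype α] [Fintype β] [DecidableEq α]
  {Y : Matrix ρ (α ⊕ β) F}

/-- The basis of the column space, as a matrix. -/
def basisMatrix (e : Expansion Y) : Matrix (Fin Y.rank) ({a // a ∈ e.col} ⊕ β) F :=
  fun t => Sum.elim (fun a => Y (e.row t) (Sum.inl a.1)) fun s => Y (e.row t) (Sum.inr s)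

/-- Independent columns have a left inverse, so a combination of the selected rows may be prescribed
freely in the basis columns. -/
theorem exists_vecMul_basisMatrix (e : Expansion Y) (c : {a // a ∈ e.col} ⊕ β → F) :
    ∃ w, w ᵥ* e.basisMatrix = c := by
  classical
  have hinj : Function.Injective e.basisMatrix.mulVec := by
    rw [Matrix.mulVec_injective_iff]
    have h : e.basisMatrix.col = Sum.elim
        (fun (a : {a // a ∈ e.col}) (t : Fin Y.rank) => Y (e.row t) (Sum.inl a.1))
        (fun (s : β) (t : Fin Y.rank) => Y (e.row t) (Sum.inr s)) := by
      ext x t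
      rcases x with x | x <;> rfl
    rw [h]
    exact e.col_indep
  obtain ⟨B, hB⟩ := Matrix.exists_mul_eq_one (A := e.basisMatrix) fun v hv =>
    hinj (hv.trans (Matrix.mulVec_zero _).symm)
  exact ⟨c ᵥ* B, by rw [Matrix.vecMul_vecMul, hB, Matrix.vecMul_one]⟩

/-- This permits cancelling `T̂` in Bob's equations. -/
theorem that_mulVec_eq_zero (e : Expansion Y) {v : β → F} (h : e.That *ᵥ v = 0) : v = 0 := by
  classical
  ext s
  obtain ⟨w, hw⟩ := e.exists_vecMul_basisMatrix (Pi.single (Sum.inr s) 1)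
  have h1 : w ᵥ* e.That = Pi.single s 1 := by
    ext s'
    refine (congrFun hw (Sum.inr s')).trans ?_
    simp [Pi.single_apply]
  have h2 := Matrix.dotProduct_mulVec w e.That v
  rw [h, h1, dotProduct_zero] at h2
  simpa using h2.symm

theorem block_mulVec_vec (e : Expansion Y) (X : Matrix β α F) :
    e.block *ᵥ Matrix.vec X = Matrix.vec (e.That *
      (X.submatrix id (Subtype.val : {a // a ∉ e.col} → α) -
        X.submatrix id (Subtype.val : {a // a ∈ e.col} → α) * e.Fz)) := by
  classical
  ext ⟨x, t⟩
  rw [Matrix.mul_sub, ← Matrix.mul_assoc]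
  simp only [Matrix.mulVec, dotProduct, Matrix.vec, Matrix.sub_apply]
  rw [Fintype.sum_prod_type, ← Fintype.sum_subtype_add_sum_subtype (fun a => a ∈ e.col)]
  have h1 : ∑ a : {a // a ∈ e.col}, ∑ s, e.block (x, t) (a.1, s) * X s a.1 =
      -(e.That * X.submatrix id (Subtype.val : {a // a ∈ e.col} → α) * e.Fz) t x := by
    rw [Matrix.mul_apply, ← Finset.sum_neg_distrib]
    refine Finset.sum_congr rfl fun a _ => ?_
    rw [Matrix.mul_apply, Finset.sum_mul, ← Finset.sum_neg_distrib]
    refine Finset.sum_congr rfl fun s _ => ?_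
    simp only [block, a.2, dite_true, Matrix.submatrix_apply, id]
    ring
  have h2 : ∑ a : {a // a ∉ e.col}, ∑ s, e.block (x, t) (a.1, s) * X s a.1 =
      (e.That * X.submatrix id (Subtype.val : {a // a ∉ e.col} → α)) t x := by
    rw [Finset.sum_eq_single x]
    · rw [Matrix.mul_apply]
      refine Finset.sum_congr rfl fun s _ => ?_
      simp [block, x.2]
    · intro a _ hax
      refine Finset.sum_eq_zero fun s _ => ?_
      have : a.1 ≠ x.1 := fun h => hax (Subtype.ext h)
      simp [block, a.2, this]
    · simp
  rw [sub_eq_add_neg, ← h1, ← h2, add_comm]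
  congr 1
  exact Finset.sum_congr (by ext; simp) fun _ _ => rfl

variable [Fintype ρ]

theorem rowSpace_row (e : Expansion Y) : rowSpace (Y.submatrix e.row id) = rowSpace Y := by
  refine Submodule.eq_of_le_of_finrank_eq (Submodule.span_mono ?_) ?_
  · rintro _ ⟨t, rfl⟩
    exact ⟨e.row t, rfl⟩
  · have h : LinearIndependent F (Y.submatrix e.row id).row := e.row_indep
    rw [rowSpace, rowSpace, ← Matrix.rank_eq_finrank_span_row, ← Matrix.rank_eq_finrank_span_row,
      h.rank_matrix, Fintype.card_fin]

/-- In terms of the expansion, the rows of `(X I)` lie in the row space of `Y` if and only if the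
part of `X` in the columns that are not selected is determined by the other part. -/
theorem forall_mem_rowSpace_iff [DecidableEq β] (e : Expansion Y) (X : Matrix β α F) :
    (∀ s, Matrix.fromCols X (1 : Matrix β β F) s ∈ rowSpace Y) ↔
      X.submatrix id (Subtype.val : {a // a ∉ e.col} → α) =
        e.Fx + X.submatrix id (Subtype.val : {a // a ∈ e.col} → α) * e.Fz := by
  -- In any combination of the selected rows, the basis columns determine the other columns through
  -- `Fz` and `Fx`.
  have hexp : ∀ (w : Fin Y.rank → F) (a : {a // a ∉ e.col}),
      (w ᵥ* Y.submatrix e.row id) (Sum.inl a.1) =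
      ((w ᵥ* Y.submatrix e.row (fun a : {a // a ∈ e.col} => Sum.inl a.1)) ᵥ* e.Fz) a +
      ((w ᵥ* Y.submatrix e.row Sum.inr) ᵥ* e.Fx) a := by
    intro w a
    rw [Matrix.vecMul_vecMul, Matrix.vecMul_vecMul, ← Pi.add_apply, ← Matrix.vecMul_add,
      ← e.expand]
    rfl
  rw [← e.rowSpace_row]
  constructor
  · intro h
    ext s a
    obtain ⟨w, hw⟩ := mem_rowSpace_iff.1 (h s)
    have h1 : w ᵥ* Y.submatrix e.row (fun a : {a // a ∈ e.col} => Sum.inl a.1) =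
        fun a => X s a.1 := by
      ext a'
      exact congrFun hw (Sum.inl a'.1)
    have h2 : w ᵥ* Y.submatrix e.row Sum.inr = Pi.single s 1 := by
      ext s'
      refine (congrFun hw (Sum.inr s')).trans ?_
      simp [Matrix.one_apply, Pi.single_apply, eq_comm]
    have h3 := hexp w a
    rw [hw, h1, h2] at h3
    rw [Matrix.add_apply, add_comm]
    rw [Matrix.single_one_vecMul] at h3
    exact h3
  · intro h s
    obtain ⟨w, hw⟩ := e.exists_vecMul_basisMatrix
      (Sum.elim (fun a => X s a.1) (Pi.single s 1))
    have h1 : w ᵥ* Y.submatrix e.row (fun a : {a // a ∈ e.col} => Sum.inl a.1) =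
        fun a => X s a.1 := by
      ext a'
      exact congrFun hw (Sum.inl a')
    have h2 : w ᵥ* Y.submatrix e.row Sum.inr = Pi.single s 1 := by
      ext s'
      exact congrFun hw (Sum.inr s')
    refine mem_rowSpace_iff.2 ⟨w, ?_⟩
    ext x
    rcases x with a | s'
    · by_cases ha : a ∈ e.col
      · exact congrFun h1 ⟨a, ha⟩
      · have h3 := congrFun (congrFun h s) ⟨a, ha⟩
        rw [hexp w ⟨a, ha⟩, h1, h2, Matrix.fromCols_apply_inl]
        rw [Matrix.add_apply, add_comm] at h3
        rw [Matrix.single_one_vecMul]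
        exact h3.symm
    · refine (congrFun h2 s').trans ?_
      simp [Matrix.one_apply, Pi.single_apply, eq_comm]

theorem block_mulVec_vec_eq_rhs_iff [DecidableEq β] (e : Expansion Y) (X : Matrix β α F) :
    e.block *ᵥ Matrix.vec X = e.rhs ↔
      ∀ s, Matrix.fromCols X (1 : Matrix β β F) s ∈ rowSpace Y := by
  rw [forall_mem_rowSpace_iff e, block_mulVec_vec, rhs, Matrix.vec_inj, ← sub_eq_iff_eq_add]
  refine ⟨fun h => ?_, fun h => by rw [h]⟩
  rw [← sub_eq_zero, ← Matrix.mul_sub] at h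
  ext s x
  have h1 := e.that_mulVec_eq_zero (v := fun s => ((X.submatrix id
    (Subtype.val : {a // a ∉ e.col} → α) - X.submatrix id
    (Subtype.val : {a // a ∈ e.col} → α) * e.Fz) - e.Fx) s x) (by
      ext t
      exact congrFun (congrFun h t) x)
  exact sub_eq_zero.1 (congrFun h1 s)

/-- Some `A` maps the columns in `β` to the identity matrix, so these columns are independent and
extend to a basis of the column space. -/
theorem nonempty_of_forall_mem_rowSpace [DecidableEq β] {X : Matrix β α F}
    (h : ∀ s, Matrix.fromCols X (1 : Matrix β β F) s ∈ rowSpace Y) : Nonempty (Expansion Y) := by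
  classical
  obtain ⟨κ, f, hf, hspan, hli⟩ := exists_linearIndependent' F Y
  have := Fintype.ofInjective f hf
  have hrank : Fintype.card κ = Y.rank := by
    rw [Matrix.rank_eq_finrank_span_row, ← finrank_span_eq_card hli, hspan]
    rfl
  let row : Fin Y.rank → ρ := f ∘ (Fintype.equivFinOfCardEq hrank).symm
  have hrow : LinearIndependent F (fun t => Y (row t)) :=
    hli.comp _ (Equiv.injective _)
  set Y' : Matrix (Fin Y.rank) (α ⊕ β) F := Y.submatrix row id with hY'
  have hrank' : Y'.rank = Y.rank := by
    have : LinearIndependent F Y'.row := hrow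
    rw [this.rank_matrix, Fintype.card_fin]
  have hspan' : rowSpace Y' = rowSpace Y := by
    refine Submodule.eq_of_le_of_finrank_eq (Submodule.span_mono ?_) ?_
    · rintro _ ⟨t, rfl⟩
      exact ⟨row t, rfl⟩
    · rw [rowSpace, rowSpace, ← Matrix.rank_eq_finrank_span_row,
        ← Matrix.rank_eq_finrank_span_row, hrank']
  rw [← hspan'] at h
  obtain ⟨A, hA⟩ := exists_mul_eq_of_forall_mem_rowSpace h
  have hβ : LinearIndependent F (fun s : β => Y'.col (Sum.inr s)) := by
    have h1 : A * Y'.submatrix id Sum.inr = 1 := by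
      ext s s'
      exact congrFun (congrFun hA s) (Sum.inr s')
    have h2 : Function.Injective (Y'.submatrix id (Sum.inr : β → α ⊕ β)).mulVec := by
      intro v v' hv
      have := congrArg (A *ᵥ ·) hv
      simpa [Matrix.mulVec_mulVec, h1] using this
    exact Matrix.mulVec_injective_iff.1 h2
  have hβ' : LinearIndepOn F Y'.col (Set.range (Sum.inr : β → α ⊕ β)) := by
    rw [linearIndepOn_range_iff Sum.inr_injective]
    exact hβ
  -- The extension already contains all columns in `β`, so whatever it adds lies in `α`.
  obtain ⟨b, -, hb, hbspan, hbli⟩ := exists_linearIndepOn_extension hβ' (Set.subset_univ _)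
  let col : Finset α := Finset.univ.filter fun a => Sum.inl a ∈ b
  let ι : {a // a ∈ col} ⊕ β → b := Sum.elim
    (fun a => ⟨Sum.inl a.1, (Finset.mem_filter.1 a.2).2⟩) fun s => ⟨Sum.inr s, hb ⟨s, rfl⟩⟩
  have hι : Function.Bijective ι := by
    constructor
    · rintro (a | s) (a' | s') haa
      · exact congrArg Sum.inl (Subtype.ext (Sum.inl_injective (congrArg Subtype.val haa)))
      · exact absurd (congrArg Subtype.val haa) Sum.inl_ne_inr
      · exact absurd (congrArg Subtype.val haa) Sum.inr_ne_inl
      · exact congrArg Sum.inr (Sum.inr_injective (congrArg Subtype.val haa))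
    · rintro ⟨a | s, hx⟩
      · exact ⟨Sum.inl ⟨a, Finset.mem_filter.2 ⟨Finset.mem_univ _, hx⟩⟩, rfl⟩
      · exact ⟨Sum.inr s, rfl⟩
  have hfam : (fun x => Y'.col (ι x).1) = Sum.elim
      (fun (a : {a // a ∈ col}) (t : Fin Y.rank) => Y (row t) (Sum.inl a.1))
      (fun (s : β) (t : Fin Y.rank) => Y (row t) (Sum.inr s)) := by
    ext x t
    rcases x with x | x <;> rfl
  have hcol : LinearIndependent F (fun x => Y'.col (ι x).1) := hbli.comp ι hι.1
  have hsp : ∀ y, Y'.col y ∈ Submodule.span F (Set.range fun x => Y'.col (ι x).1) := by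
    intro y
    have h1 : Y'.col '' b = Set.range fun x => Y'.col (ι x).1 := by
      have : (Set.range fun x => (ι x).1) = b := by
        rw [show (fun x => (ι x).1) = Subtype.val ∘ ι from rfl, hι.2.range_comp,
          Subtype.range_val]
      rw [show (fun x => Y'.col (ι x).1) = Y'.col ∘ fun x => (ι x).1 from rfl, Set.range_comp,
        this]
    rw [← h1]
    exact hbspan ⟨y, trivial, rfl⟩
  have hcard : col.card + Fintype.card β = Y.rank := by
    have h1 := finrank_span_eq_card hcol
    have h2 : Submodule.span F (Set.range fun x => Y'.col (ι x).1) =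
        Submodule.span F (Set.range Y'.col) := by
      refine le_antisymm (Submodule.span_mono ?_) (Submodule.span_le.2 ?_)
      · rintro _ ⟨x, rfl⟩
        exact ⟨_, rfl⟩
      · rintro _ ⟨y, rfl⟩
        exact hsp y
    rw [h2, ← Matrix.rank_eq_finrank_span_cols, hrank', Fintype.card_sum, Fintype.card_coe] at h1
    exact h1.symm
  have hcoef := fun a : {a // a ∉ col} =>
    (Submodule.mem_span_range_iff_exists_fun F).1 (hsp (Sum.inl a.1))
  choose c hc using hcoef
  refine ⟨⟨row, hrow, col, hfam ▸ hcol, hcard, Matrix.of fun a x => c x (Sum.inl a),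
    Matrix.of fun s x => c x (Sum.inr s), ?_⟩⟩
  ext t a
  have h1 := congrFun (hc a) t
  rw [Fintype.sum_sum_type, Pi.add_apply, Finset.sum_apply, Finset.sum_apply] at h1
  rw [Matrix.add_apply, Matrix.mul_apply, Matrix.mul_apply]
  refine h1.symm.trans ?_
  congr 1 <;> exact Finset.sum_congr rfl fun _ _ => mul_comm _ _

end Expansion

namespace Session

theorem exists_eq_sumElim {P : Session} {F : Type} {i : ℕ} (v : P.Unknown i → F) :
    ∃ (W : P.Message F) (l : P.Suffixes F i), v = Sum.elim (Matrix.vec W) fun u => l u.1 u.2 := by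
  refine ⟨Matrix.of fun r x => v (Sum.inl (x, r)), fun k u => v (Sum.inr ⟨k, u⟩), ?_⟩
  ext x
  rcases x with x | x <;> rfl

variable {P : Session} {F : Type} [Field F] {i : ℕ}

/-! ### The solutions of Bob's linear system -/

/-- The message `W` is consistent with the received matrices and with the shared secret. -/
def Consistent (P : Session) {ρ ρ' : Type} (Y : Matrix ρ P.LongCol F)
    (J : Matrix ρ' (P.ShortCol i) F) (s : P.Secret F i) (W : P.Message F) : Prop :=
  (∀ r, P.X0 W r ∈ rowSpace Y) ∧ ∀ r, P.suffixMatrix (P.suffix s W) r ∈ rowSpace J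

/-- The part `𝓛` of the suffix matrix. -/
def suffixPart (P : Session) (l : P.Suffixes F i) :
    Matrix (Fin i × Fin P.σ) (Fin (i * P.m)) F :=
  fun r c => if hc : (c : ℕ) < (r.1 + 1) * P.m then l r.1 (r.2, ⟨c, hc⟩) else 0

theorem hashPos_injective (P : Session) : Function.Injective (P.hashPos (i := i)) := by
  rintro ⟨k, r, c⟩ ⟨k', r', c'⟩ h
  simp only [hashPos, Prod.mk.injEq] at h
  obtain ⟨h1, rfl, rfl⟩ := h
  obtain rfl := Fin.castLE_injective _ h1
  rfl

theorem vec_suffixPart_hashPos (l : P.Suffixes F i) (u : Σ k : Fin i, P.HashIdx k) :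
    Matrix.vec (P.suffixPart l) (P.hashPos u) = l u.1 u.2 := by
  simp [Matrix.vec, suffixPart, hashPos]

theorem vec_suffixPart_eq_zero (l : P.Suffixes F i) {p : Fin (i * P.m) × (Fin i × Fin P.σ)}
    (hp : p ∉ Set.range (P.hashPos (i := i))) : Matrix.vec (P.suffixPart l) p = 0 := by
  obtain ⟨c, k, r⟩ := p
  simp only [Matrix.vec, suffixPart, dite_eq_right_iff]
  intro hc
  exact absurd ⟨⟨k, r, ⟨c, hc⟩⟩, rfl⟩ hp

/-- The dummy zeros contribute nothing, so dropping their columns leaves an equation for the full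
padded matrix. -/
theorem submatrix_hashPos_mulVec {ρ : Type} (M : Matrix ρ (Fin (i * P.m) × (Fin i × Fin P.σ)) F)
    (l : P.Suffixes F i) : M.submatrix id P.hashPos *ᵥ (fun u => l u.1 u.2) =
      M *ᵥ Matrix.vec (P.suffixPart l) := by
  ext x
  refine Fintype.sum_of_injective P.hashPos P.hashPos_injective _ _ ?_ ?_
  · intro p hp
    rw [vec_suffixPart_eq_zero l hp, mul_zero]
  · intro u
    rw [vec_suffixPart_hashPos]
    rfl

theorem botMatrix_mulVec (s : P.Secret F i) (x : Fin P.n × Fin P.b → F)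
    (y : (Σ k : Fin i, P.HashIdx k) → F) : P.botMatrix s *ᵥ Sum.elim x y =
      fun u => (P.parity (s.d u.1) *ᵥ x) u.2 + y u := by
  refine (Matrix.fromCols_mulVec_sumElim _ _ _ _).trans ?_
  rw [Matrix.one_mulVec]
  rfl

variable {ρ ρ' : Type} [Fintype ρ] [Fintype ρ'] {Y : Matrix ρ P.LongCol F}
  {J : Matrix ρ' (P.ShortCol i) F}

/-- The two upper block rows are the row space tests for `Y` and `J`; the bottom one fixes `l`.
Bob's choice of rows and columns disappears from the right-hand side. -/
theorem sysMatrix_mulVec_eq_iff (eY : Expansion Y) (eJ : Expansion J) (s : P.Secret F i)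
    (W : P.Message F) (l : P.Suffixes F i) :
    P.sysMatrix eY eJ s *ᵥ Sum.elim (Matrix.vec W) (fun u => l u.1 u.2) = P.sysRhs eY eJ s ↔
      P.Consistent Y J s W ∧ l = P.suffix s W := by
  have h1 : P.sysMatrix eY eJ s *ᵥ Sum.elim (Matrix.vec W) (fun u => l u.1 u.2) =
      P.sysRhs eY eJ s ↔
      (eY.block *ᵥ Matrix.vec W = eY.rhs ∧ eJ.block *ᵥ Matrix.vec (P.suffixPart l) = eJ.rhs) ∧
        ∀ k, P.parity (s.d k) *ᵥ Matrix.vec W + l k = s.h k := by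
    rw [sysMatrix, sysRhs, Matrix.fromRows_mulVec, Matrix.fromBlocks_mulVec, Sum.elim_eq_iff,
      Sum.elim_eq_iff]
    simp only [Sum.elim_comp_inl, Sum.elim_comp_inr, Matrix.zero_mulVec, add_zero, zero_add,
      submatrix_hashPos_mulVec]
    refine and_congr_right fun _ => ?_
    rw [botMatrix_mulVec]
    constructor
    · intro h k
      ext u
      exact congrFun h ⟨k, u⟩
    · intro h
      ext u
      exact congrFun (h u.1) u.2
  rw [h1, eY.block_mulVec_vec_eq_rhs_iff, eJ.block_mulVec_vec_eq_rhs_iff]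
  have h2 : (∀ k, P.parity (s.d k) *ᵥ Matrix.vec W + l k = s.h k) ↔
      l = P.suffix s W := by
    constructor
    · intro h
      ext k u
      simp [suffix, ← h k]
    · rintro rfl k
      simp [suffix]
  rw [h2]
  constructor
  · rintro ⟨⟨h3, h4⟩, rfl⟩
    exact ⟨⟨h3, h4⟩, rfl⟩
  · rintro ⟨⟨h3, h4⟩, rfl⟩
    exact ⟨⟨h3, h4⟩, rfl⟩

theorem solve_eq_decoded (eY : Expansion Y) (eJ : Expansion J) (s : P.Secret F i)
    {W : P.Message F} (hW : P.Consistent Y J s W) (huniq : ∀ W', P.Consistent Y J s W' → W' = W) :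
    P.solve eY eJ s = Outcome.decoded (P.X0 W) := by
  have hall : ∀ v, P.sysMatrix eY eJ s *ᵥ v = P.sysRhs eY eJ s →
      v = Sum.elim (Matrix.vec W) fun u => P.suffix s W u.1 u.2 := by
    intro v hv
    obtain ⟨W', l', rfl⟩ := exists_eq_sumElim v
    obtain ⟨h1, rfl⟩ := (sysMatrix_mulVec_eq_iff eY eJ s W' l').1 hv
    rw [huniq W' h1]
  have hex : ∃! v, P.sysMatrix eY eJ s *ᵥ v = P.sysRhs eY eJ s :=
    ⟨_, (sysMatrix_mulVec_eq_iff eY eJ s W _).2 ⟨hW, rfl⟩, hall⟩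
  rw [solve, dif_pos hex]
  congr 2
  ext r x
  exact congrFun (hall _ hex.choose_spec.1) (Sum.inl (x, r))

theorem solve_eq_wait (eY : Expansion Y) (eJ : Expansion J) (s : P.Secret F i)
    (h : ∀ W', ¬ P.Consistent Y J s W') : P.solve eY eJ s = Outcome.wait := by
  have hall : ∀ v, P.sysMatrix eY eJ s *ᵥ v ≠ P.sysRhs eY eJ s := by
    intro v hv
    obtain ⟨W', l', rfl⟩ := exists_eq_sumElim v
    exact h W' ((sysMatrix_mulVec_eq_iff eY eJ s W' l').1 hv).1
  rw [solve, dif_neg fun ⟨v, hv, _⟩ => hall v hv, if_neg fun ⟨v, hv⟩ => hall v hv]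

variable {W : P.Message F} {A : P.Calvin F i} {sel : P.Selection F i}
  {ω : P.Coding F i × P.Secret F i}

/-- The messages that Bob considers as possible. -/
def Plausible (P : Session) (W : P.Message F) (A : P.Calvin F i)
    (ω : P.Coding F i × P.Secret F i) (W' : P.Message F) : Prop :=
  P.Consistent (P.recvLong W A ω.1 (P.suffix ω.2 W)) (P.recvShort A ω.1 (P.suffix ω.2 W)) ω.2 W'

theorem result_eq_decoded (hW : P.Plausible W A ω W)
    (huniq : ∀ W', P.Plausible W A ω W' → W' = W) :
    P.result W A sel ω = Outcome.decoded (P.X0 W) := by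
  have h : Nonempty (Expansion (P.recvLong W A ω.1 (P.suffix ω.2 W))) ∧
      Nonempty (Expansion (P.recvShort A ω.1 (P.suffix ω.2 W))) :=
    ⟨Expansion.nonempty_of_forall_mem_rowSpace hW.1,
      Expansion.nonempty_of_forall_mem_rowSpace hW.2⟩
  rw [result, decode, dif_pos h]
  exact solve_eq_decoded _ _ _ hW huniq

theorem result_eq_wait (h : ∀ W', ¬ P.Plausible W A ω W') :
    P.result W A sel ω = Outcome.wait := by
  rw [result, decode]
  split_ifs with h'
  · exact solve_eq_wait _ _ _ h
  · rfl

theorem result_eq_wait_or_decoded (huniq : ∀ W', P.Plausible W A ω W' → W' = W) :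
    P.result W A sel ω = Outcome.wait ∨ P.result W A sel ω = Outcome.decoded (P.X0 W) := by
  by_cases h : P.Plausible W A ω W
  · exact Or.inr (result_eq_decoded h huniq)
  · exact Or.inl (result_eq_wait fun W' h' => h (huniq W' h' ▸ h'))

end Session

/-! ### Stacked matrices -/

section Stack

variable {F : Type} [Field F] {ι : Type} [Fintype ι] {ρ κ : ι → Type} [∀ j, Fintype (ρ j)]
  [∀ j, Fintype (κ j)]

/-- `V` is what the stages share and is counted only once: it is `⊥` for long packets and the row
space of the suffix matrix for short ones. -/
theorem finrank_rowSpace_stack_le {n : Type} [Fintype n] (Y : Matrix (Σ j, ρ j) n F)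
    (V : Submodule F (n → F)) (B : ∀ j, Matrix (ρ j) n F)
    (h : ∀ e, Y e ∈ V ⊔ rowSpace (B e.1)) :
    Module.finrank F (rowSpace Y) ≤ Module.finrank F V + ∑ j, (B j).rank := by
  classical
  have h1 : rowSpace Y ≤ V ⊔ Finset.univ.sup fun j => rowSpace (B j) := by
    refine Submodule.span_le.2 ?_
    rintro _ ⟨e, rfl⟩
    exact sup_le_sup_left (Finset.le_sup (f := fun j => rowSpace (B j)) (Finset.mem_univ e.1)) V
      (h e)
  have h2 : ∀ s : Finset ι, Module.finrank F ↥(s.sup fun j => rowSpace (B j)) ≤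
      ∑ j ∈ s, (B j).rank := by
    intro s
    induction s using Finset.induction_on with
    | empty => simp
    | insert a s ha ih =>
      rw [Finset.sup_insert, Finset.sum_insert ha]
      refine (Submodule.finrank_add_le_finrank_add_finrank _ _).trans ?_
      gcongr
      rw [rowSpace, Matrix.rank_eq_finrank_span_row]
  refine (Submodule.finrank_mono h1).trans ?_
  refine (Submodule.finrank_add_le_finrank_add_finrank _ _).trans ?_
  gcongr
  exact h2 _

/-- If the columns of the stacked `T j` are independent modulo those of the `Q j`, then they can be
separated from the latter by row operations. -/
theorem exists_separating {β : Type} [Fintype β] [DecidableEq β] (T : ∀ j, Matrix (ρ j) β F)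
    (Q : ∀ j, Matrix (ρ j) (κ j) F)
    (h : ∀ v, (∀ j, T j *ᵥ v ∈ LinearMap.range (Q j).mulVecLin) → v = 0) :
    ∃ A : ∀ j, Matrix β (ρ j) F, ∑ j, A j * T j = 1 ∧ ∀ j, A j * Q j = 0 := by
  classical
  -- The hypothesis says that `Φ` is injective. The components of a left inverse, composed with the
  -- quotient maps, kill the `Q j`.
  let Φ : (β → F) →ₗ[F] ∀ j, (ρ j → F) ⧸ LinearMap.range (Q j).mulVecLin :=
    LinearMap.pi fun j => Submodule.mkQ _ ∘ₗ (T j).mulVecLin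
  have hΦ : LinearMap.ker Φ = ⊥ := by
    refine LinearMap.ker_eq_bot'.2 fun v hv => h v fun j => ?_
    have := congrFun hv j
    exact (Submodule.Quotient.mk_eq_zero _).1 this
  obtain ⟨g, hg⟩ := Φ.exists_leftInverse_of_injective hΦ
  let A : ∀ j, (ρ j → F) →ₗ[F] (β → F) := fun j => g ∘ₗ
    LinearMap.single F (fun j => (ρ j → F) ⧸ LinearMap.range (Q j).mulVecLin) j ∘ₗ
    Submodule.mkQ _
  refine ⟨fun j => LinearMap.toMatrix' (A j), ?_, fun j => ?_⟩
  · refine Matrix.toLin'.injective (LinearMap.ext fun v => ?_)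
    simp only [map_sum, Matrix.toLin'_mul, Matrix.toLin'_toMatrix', Matrix.toLin'_one,
      LinearMap.sum_apply, LinearMap.comp_apply, LinearMap.id_apply, A]
    rw [← map_sum]
    have h1 : ∑ j, LinearMap.single F
        (fun j => (ρ j → F) ⧸ LinearMap.range (Q j).mulVecLin) j
        (Submodule.mkQ _ (Matrix.toLin' (T j) v)) = Φ v :=
      LinearMap.sum_single_apply _ (Φ v)
    rw [h1]
    exact LinearMap.congr_fun hg v
  · refine Matrix.toLin'.injective (LinearMap.ext fun v => ?_)
    rw [Matrix.toLin'_mul, Matrix.toLin'_toMatrix', map_zero, LinearMap.zero_apply]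
    simp only [LinearMap.comp_apply, A]
    have h1 : Submodule.mkQ (LinearMap.range (Q j).mulVecLin) (Matrix.toLin' (Q j) v) = 0 :=
      (Submodule.Quotient.mk_eq_zero _).2 ⟨v, rfl⟩
    rw [h1, map_zero, map_zero]

end Stack

namespace Session

variable {P : Session} {F : Type} [Field F] {i : ℕ}

/-! ### The received matrices -/

/-- The packets that are injected on the hyperedges of `C`. -/
def injected {N : Network} {κ : Type} (C : Finset (Fin N.edges)) (Z : Matrix (Fin N.edges) κ F) :
    Matrix {e // e ∈ C} κ F :=
  Z.submatrix Subtype.val id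

theorem observe_eq {N : Network} {κ : Type} (a : Matrix (Fin N.edges) (Fin N.edges) F)
    (X : Matrix N.Out κ F) (C : Finset (Fin N.edges)) (Z : Matrix (Fin N.edges) κ F) :
    N.observe a X C Z = N.transferT a * X + N.transferQ a C * injected C Z :=
  rfl

theorem mul_observe {N : Network} {κ β m : Type} [Fintype β]
    (a : Matrix (Fin N.edges) (Fin N.edges) F) (K : Matrix N.Out β F) (X : Matrix β κ F)
    (C : Finset (Fin N.edges)) (Z : Matrix (Fin N.edges) κ F) (B : Matrix m N.In F) :
    B * N.observe a (K * X) C Z = B * (N.transferT a * K) * X +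
      B * N.transferQ a C * injected C Z := by
  rw [observe_eq, Matrix.mul_add, Matrix.mul_assoc, Matrix.mul_assoc, Matrix.mul_assoc]

theorem pad_add (j : Fin i) (v w : P.ShortCol (j + 1) → F) :
    P.pad j (v + w) = P.pad j v + P.pad j w := by
  ext (x | y)
  · simp only [pad, Pi.add_apply]
    split_ifs <;> simp
  · simp only [pad, Pi.add_apply]
    split_ifs <;> simp

theorem pad_vecMul (j : Fin i) {m : Type} [Fintype m] (w : m → F)
    (M : Matrix m (P.ShortCol (j + 1)) F) :
    P.pad j (w ᵥ* M) = w ᵥ* (Matrix.of fun x => P.pad j (M x)) := by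
  ext (x | y)
  · by_cases h : (x : ℕ) < (j + 1) * P.m <;> simp [pad, h, Matrix.vecMul, dotProduct]
  · by_cases h : (y.1 : ℕ) < j + 1 <;> simp [pad, h, Matrix.vecMul, dotProduct]

/-- The suffix matrices are nested, so after padding the honest short packets of all stages are
combinations of the rows of one matrix. -/
theorem pad_suffixMatrix (l : P.Suffixes F i) (j : Fin i) (r : Fin (j + 1) × Fin P.σ) :
    P.pad j (P.suffixMatrix (P.prefixSuffixes l j) r) =
      P.suffixMatrix l (Fin.castLE j.2 r.1, r.2) := by
  ext (x | y)
  · change (if hx : (x : ℕ) < (j + 1) * P.m then (if hc : (x : ℕ) < (r.1 + 1) * P.m then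
      l (Fin.castLE j.2 r.1) (r.2, ⟨x, hc⟩) else 0) else 0) =
      if hc : (x : ℕ) < (r.1 + 1) * P.m then l (Fin.castLE j.2 r.1) (r.2, ⟨x, hc⟩) else 0
    by_cases h : (x : ℕ) < (r.1 + 1) * P.m
    · have h2 : (x : ℕ) < (j + 1) * P.m :=
        h.trans_le (Nat.mul_le_mul_right _ (Nat.succ_le_of_lt r.1.2))
      rw [dif_pos h, dif_pos h2]
    · simp [h]
  · change (if hy : (y.1 : ℕ) < j + 1 then
      (1 : Matrix (Fin (j + 1) × Fin P.σ) (Fin (j + 1) × Fin P.σ) F) r (⟨y.1, hy⟩, y.2) else 0) =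
      (1 : Matrix (Fin i × Fin P.σ) (Fin i × Fin P.σ) F) (Fin.castLE j.2 r.1, r.2) y
    simp only [Matrix.one_apply, Prod.ext_iff, Fin.ext_iff, Fin.val_castLE]
    by_cases h : (y.1 : ℕ) < j + 1
    · simp [h]
    · have h2 : ¬ ((r.1 : ℕ) = y.1 ∧ (r.2 : ℕ) = y.2) := fun h3 => h (h3.1 ▸ r.1.2)
      simp [h, h2]

/-- The rows of `L^(i)` that are involved at stage `j`. -/
def stageSuffixes (P : Session) (l : P.Suffixes F i) (j : Fin i) :
    Matrix (Fin (j + 1) × Fin P.σ) (P.ShortCol i) F :=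
  Matrix.of fun r => P.suffixMatrix l (Fin.castLE j.2 r.1, r.2)

/-- Calvin's short packets at stage `j`, in the format of stage `i`. -/
def paddedErrors (P : Session) (A : P.Calvin F i) (c : P.Coding F i) (l : P.Suffixes F i)
    (j : Fin i) : Matrix {e // e ∈ A.locShort c l j} (P.ShortCol i) F :=
  Matrix.of fun e => P.pad j (A.E c l j e.1)

theorem recvShort_apply (A : P.Calvin F i) (c : P.Coding F i) (l : P.Suffixes F i) (j : Fin i)
    (x : (P.short j).In) :
    P.recvShort A c l ⟨j, x⟩ =
      ((P.short j).transferT (c.aShort j) * c.G j) x ᵥ* P.stageSuffixes l j +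
      (P.short j).transferQ (c.aShort j) (A.locShort c l j) x ᵥ* P.paddedErrors A c l j := by
  have h1 : P.recvShort A c l ⟨j, x⟩ = P.pad j
    (((P.short j).transferT (c.aShort j) * c.G j) x ᵥ* P.suffixMatrix (P.prefixSuffixes l j) +
      (P.short j).transferQ (c.aShort j) (A.locShort c l j) x ᵥ*
        injected (A.locShort c l j) (A.E c l j)) := by
    have h2 : ((P.short j).transferT (c.aShort j) * c.G j) x ᵥ*
        P.suffixMatrix (P.prefixSuffixes l j) = (P.short j).transferT (c.aShort j) x ᵥ*
        (c.G j * P.suffixMatrix (P.prefixSuffixes l j)) := by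
      rw [← Matrix.vecMul_vecMul]
      rfl
    rw [h2]
    rfl
  rw [h1, pad_add, pad_vecMul, pad_vecMul]
  congr 2
  exact congrArg Matrix.of (funext fun r => pad_suffixMatrix l j r)

theorem finrank_rowSpace_recvLong_le (W : P.Message F) (A : P.Calvin F i) (c : P.Coding F i)
    (l : P.Suffixes F i) : Module.finrank F (rowSpace (P.recvLong W A c l)) ≤
      ∑ j : Fin i, (Fintype.card (P.long j).Out +
        (P.long j).errorCut (A.locLong c l j)) := by
  have h := finrank_rowSpace_stack_le (P.recvLong W A c l) ⊥
    (fun j : Fin i => (P.long j).observe (c.aLong j) (c.K j * P.X0 W)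
      (A.locLong c l j) (A.Z c l j))
    (fun e => Submodule.mem_sup_right (row_mem_rowSpace ((P.long e.1).observe (c.aLong e.1)
      (c.K e.1 * P.X0 W) (A.locLong c l e.1) (A.Z c l e.1)) e.2))
  rw [finrank_bot, zero_add] at h
  refine h.trans (Finset.sum_le_sum fun j _ => ?_)
  refine (Matrix.rank_add_le' _ _).trans (add_le_add ?_ ?_)
  · exact (Matrix.rank_mul_le_left _ _).trans (Matrix.rank_le_card_width _)
  · exact (Matrix.rank_mul_le_left _ _).trans ((P.long j).rank_transferQ_le _ _)

theorem finrank_rowSpace_recvShort_le (A : P.Calvin F i) (c : P.Coding F i)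
    (l : P.Suffixes F i) : Module.finrank F (rowSpace (P.recvShort A c l)) ≤
      i * P.σ + ∑ j : Fin i, (P.short j).errorCut (A.locShort c l j) := by
  have h := finrank_rowSpace_stack_le (P.recvShort A c l) (rowSpace (P.suffixMatrix l))
    (fun j : Fin i => (P.short j).transferQ (c.aShort j) (A.locShort c l j) *
      P.paddedErrors A c l j) (by
      rintro ⟨j, x⟩
      rw [recvShort_apply]
      refine Submodule.add_mem_sup ?_ (row_mem_rowSpace
        ((P.short j).transferQ (c.aShort j) (A.locShort c l j) * P.paddedErrors A c l j) x)
      rw [Matrix.vecMul_eq_sum]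
      exact Submodule.sum_mem _ fun r _ => Submodule.smul_mem _ _ (row_mem_rowSpace _ _))
  refine h.trans (add_le_add ?_ (Finset.sum_le_sum fun j _ => ?_))
  · rw [rowSpace, ← Matrix.rank_eq_finrank_span_row]
    refine (Matrix.rank_le_card_height _).trans ?_
    simp
  · exact (Matrix.rank_mul_le_left _ _).trans ((P.short j).rank_transferQ_le _ _)

/-! ### Recovering the true packets from the received rows, and its limits -/

/-- If the errors can be separated from the message, then the message is found among the packets
that Bob receives. -/
theorem X0_mem_rowSpace_recvLong (W : P.Message F) (A : P.Calvin F i) (c : P.Coding F i)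
    (l : P.Suffixes F i)
    (h : ∀ v, (∀ j : Fin i, (P.long j).transferT (c.aLong j) *ᵥ (c.K j *ᵥ v) ∈
      LinearMap.range ((P.long j).transferQ (c.aLong j) (A.locLong c l j)).mulVecLin) → v = 0)
    (r : Fin P.b) : P.X0 W r ∈ rowSpace (P.recvLong W A c l) := by
  obtain ⟨B, hB1, hB2⟩ := exists_separating
    (fun j : Fin i => (P.long j).transferT (c.aLong j) * c.K j)
    (fun j : Fin i => (P.long j).transferQ (c.aLong j) (A.locLong c l j))
    (by simpa only [← Matrix.mulVec_mulVec] using h)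
  have h1 : P.X0 W = ∑ j, B j * (P.long j).observe (c.aLong j) (c.K j * P.X0 W)
      (A.locLong c l j) (A.Z c l j) := by
    rw [Finset.sum_congr rfl (g := fun j => B j * ((P.long j).transferT (c.aLong j) * c.K j) *
      P.X0 W) fun j _ => by rw [mul_observe, hB2, Matrix.zero_mul, add_zero]]
    rw [← Matrix.sum_mul, hB1, Matrix.one_mul]
  have h1r : P.X0 W r = ∑ j, (B j * (P.long j).observe (c.aLong j) (c.K j * P.X0 W)
      (A.locLong c l j) (A.Z c l j)) r := by
    ext x
    rw [Finset.sum_apply, ← Matrix.sum_apply, ← h1]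
  rw [h1r]
  refine Submodule.sum_mem _ fun j _ => ?_
  have h2 := mul_mem_rowSpace (B j) ((P.long j).observe (c.aLong j) (c.K j * P.X0 W)
      (A.locLong c l j) (A.Z c l j)) r
  refine (Submodule.span_mono ?_ : rowSpace _ ≤ rowSpace _) h2
  rintro _ ⟨x, rfl⟩
  exact ⟨⟨j, x⟩, rfl⟩

/-- A vector supported on the last block. -/
def lastBlock (P : Session) (j : ℕ) (v : Fin P.σ → F) : Fin (j + 1) × Fin P.σ → F :=
  fun r => if r.1 = Fin.last j then v r.2 else 0

theorem mulVec_lastBlock {m : Type} {j : ℕ} (G : Matrix m (Fin (j + 1) × Fin P.σ) F)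
    (v : Fin P.σ → F) :
    G *ᵥ P.lastBlock j v = G.submatrix id (fun s => (Fin.last j, s)) *ᵥ v := by
  ext x
  simp only [Matrix.mulVec, dotProduct, lastBlock, Fintype.sum_prod_type, mul_ite, mul_zero]
  rw [Finset.sum_eq_single (Fin.last j)]
  · simp
  · intro k _ hk
    simp [hk]
  · simp

/-- Strong induction on the stage. Separating only the last column block of `G_j` from the errors
yields each new row up to a combination of older rows, which are already in the row space. -/
theorem suffixMatrix_mem_rowSpace_recvShort (A : P.Calvin F i) (c : P.Coding F i)
    (l : P.Suffixes F i)
    (h : ∀ (j : Fin i) (v : Fin P.σ → F),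
      (P.short j).transferT (c.aShort j) *ᵥ (c.G j *ᵥ P.lastBlock j v) ∈
      LinearMap.range ((P.short j).transferQ (c.aShort j) (A.locShort c l j)).mulVecLin → v = 0)
    (r : Fin i × Fin P.σ) : P.suffixMatrix l r ∈ rowSpace (P.recvShort A c l) := by
  obtain ⟨⟨j, hj⟩, s⟩ := r
  induction j using Nat.strong_induction_on generalizing s with
  | _ j ih =>
  set J : Fin i := ⟨j, hj⟩ with hJ
  obtain ⟨B, hB1, hB2⟩ := exists_separating (ι := Unit)
    (fun _ => (P.short J).transferT (c.aShort J) *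
      (c.G J).submatrix id (fun s => (Fin.last j, s)))
    (fun _ => (P.short J).transferQ (c.aShort J) (A.locShort c l J))
    (by
      intro v hv
      refine h J v ?_
      have := hv ()
      rw [← Matrix.mulVec_mulVec] at this
      rwa [mulVec_lastBlock])
  simp only [Finset.univ_unique, Finset.sum_singleton] at hB1
  have hB2' := hB2 ()
  set B' := B () with hB'
  set M := B' * ((P.short J).transferT (c.aShort J) * c.G J) with hM
  have hmem : (M s) ᵥ* P.stageSuffixes l J ∈ rowSpace (P.recvShort A c l) := by
    have h1 : (M s) ᵥ* P.stageSuffixes l J =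
        ∑ x, B' s x • P.recvShort A c l ⟨J, x⟩ := by
      simp only [recvShort_apply, smul_add, Finset.sum_add_distrib]
      have h2 : ∑ x, B' s x • ((P.short J).transferT (c.aShort J) * c.G J) x ᵥ*
          P.stageSuffixes l J = (M s) ᵥ* P.stageSuffixes l J := by
        have : M s = B' s ᵥ* ((P.short J).transferT (c.aShort J) * c.G J) := rfl
        rw [this, Matrix.vecMul_vecMul, Matrix.vecMul_eq_sum]
        rfl
      have h3 : ∑ x, B' s x • (P.short J).transferQ (c.aShort J) (A.locShort c l J) x ᵥ*
          P.paddedErrors A c l J = 0 := by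
        have : (B' * (P.short J).transferQ (c.aShort J) (A.locShort c l J)) s = 0 := by
          rw [hB2']; rfl
        have h4 : (B' * (P.short J).transferQ (c.aShort J) (A.locShort c l J)) s ᵥ*
            P.paddedErrors A c l J = 0 := by rw [this, Matrix.zero_vecMul]
        have h5 : (B' * (P.short J).transferQ (c.aShort J) (A.locShort c l J)) s =
          B' s ᵥ* (P.short J).transferQ (c.aShort J) (A.locShort c l J) := rfl
        rw [h5, Matrix.vecMul_vecMul, Matrix.vecMul_eq_sum] at h4
        exact h4
      rw [h2, h3, add_zero]
    rw [h1]
    exact Submodule.sum_mem _ fun x _ => Submodule.smul_mem _ _ (row_mem_rowSpace _ _)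
  have hlast : ∀ s', M s (Fin.last j, s') = (1 : Matrix (Fin P.σ) (Fin P.σ) F) s s' := by
    intro s'
    rw [← hB1, hM]
    rfl
  -- By `hlast` the newest block enters with the identity; the remaining terms are covered by the
  -- induction hypothesis.
  have hsum : (M s) ᵥ* P.stageSuffixes l J = P.suffixMatrix l (J, s) +
      ∑ k : Fin j, ∑ s', M s (k.castSucc, s') •
        P.suffixMatrix l (⟨k, k.2.trans hj⟩, s') := by
    rw [Matrix.vecMul_eq_sum, Fintype.sum_prod_type, Fin.sum_univ_castSucc, add_comm]
    congr 1
    rw [Finset.sum_eq_single s]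
    · have h1 : M s (Fin.last j, s) = 1 := by rw [hlast, Matrix.one_apply_eq]
      refine (congrArg (· • _) h1).trans ?_
      rw [one_smul]
      rfl
    · intro s' _ hs'
      have h1 : M s (Fin.last j, s') = 0 := by rw [hlast, Matrix.one_apply_ne hs'.symm]
      refine (congrArg (· • _) h1).trans ?_
      rw [zero_smul]
    · simp
  rw [hsum] at hmem
  exact (Submodule.add_mem_iff_left _ (Submodule.sum_mem _ fun (k : Fin j) _ =>
    Submodule.sum_mem _ fun s' _ => Submodule.smul_mem _ _ (ih k.1 k.2 s' (k.2.trans hj)))).1 hmem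

/-- If the errors are genuine, then all of them have to fit into what Bob receives. -/
theorem card_le_of_genuineErrors (W : P.Message F) (A : P.Calvin F i) (c : P.Coding F i)
    (l : P.Suffixes F i) (hgen : A.GenuineErrors W c l)
    (h : ∀ r, P.X0 W r ∈ rowSpace (P.recvLong W A c l)) :
    P.b + ∑ j : Fin i, ((P.long j).transferQ (c.aLong j) (A.locLong c l j)).rank ≤
      ∑ j : Fin i, Fintype.card (P.long j).In := by
  obtain ⟨B, hB⟩ := exists_mul_eq_of_forall_mem_rowSpace h
  let Bj : ∀ j : Fin i, Matrix (Fin P.b) (P.long j).In F := fun j => Matrix.of fun r x => B r ⟨j, x⟩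
  have h1 : ∑ j, Bj j * (P.long j).observe (c.aLong j) (c.K j * P.X0 W)
      (A.locLong c l j) (A.Z c l j) = P.X0 W := by
    refine Eq.trans ?_ hB
    ext r x
    rw [Matrix.sum_apply, Matrix.mul_apply, Fintype.sum_sigma]
    rfl
  set M : Matrix (Fin P.b) (Fin P.b) F :=
    ∑ j : Fin i, Bj j * ((P.long j).transferT (c.aLong j) * c.K j) with hM
  have h2 : M * P.X0 W + ∑ j : Fin i, Bj j * (P.long j).transferQ (c.aLong j) (A.locLong c l j) *
      injected (A.locLong c l j) (A.Z c l j) = P.X0 W := by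
    refine Eq.trans ?_ h1
    rw [hM, Matrix.sum_mul, ← Finset.sum_add_distrib]
    exact Finset.sum_congr rfl fun j _ => (mul_observe _ _ _ _ _ _).symm
  -- `h2` is a linear relation between the rows of `X₀` and the injected packets, so all its
  -- coefficients vanish.
  have h3 : ∀ r, (∀ r', (M - 1) r r' = 0) ∧ ∀ e : (Σ j : Fin i, {e // e ∈ A.locLong c l j}),
      (Bj e.1 * (P.long e.1).transferQ (c.aLong e.1) (A.locLong c l e.1)) r e.2 = 0 := by
    intro r
    have hli := Fintype.linearIndependent_iff.1 hgen (Sum.elim (fun r' => (M - 1) r r')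
      fun e : (Σ j : Fin i, {e // e ∈ A.locLong c l j}) =>
      (Bj e.1 * (P.long e.1).transferQ (c.aLong e.1) (A.locLong c l e.1)) r e.2) (by
        rw [Fintype.sum_sum_type, Fintype.sum_sigma]
        ext x
        have h5 := congrFun (congrFun h2 r) x
        rw [Matrix.add_apply, Matrix.sum_apply, Matrix.mul_apply] at h5
        have h6 : ∑ r', (M - 1) r r' * P.X0 W r' x =
            ∑ r', M r r' * P.X0 W r' x - P.X0 W r x := by
          simp [Matrix.one_apply, sub_mul, Finset.sum_sub_distrib]
        have h7 : ∑ r', (M - 1) r r' * P.X0 W r' x + ∑ j : Fin i,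
            (Bj j * (P.long j).transferQ (c.aLong j) (A.locLong c l j) *
              injected (A.locLong c l j) (A.Z c l j)) r x = 0 := by
          rw [h6, sub_add_eq_add_sub, sub_eq_zero]
          exact h5
        simp only [Pi.add_apply, Finset.sum_apply, Pi.smul_apply, smul_eq_mul]
        exact h7)
    exact ⟨fun r' => hli (Sum.inl r'), fun e => hli (Sum.inr e)⟩
  have h4 : M = 1 := by
    ext r r'
    exact sub_eq_zero.1 ((h3 r).1 r')
  -- Since `Bj j` annihilates `Q_j`, their ranks share the space of received packets; since `M = 1`,
  -- the ranks of the `Bj j` add up to at least `b`.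
  have h5 : ∀ j : Fin i, (Bj j).rank + ((P.long j).transferQ (c.aLong j) (A.locLong c l j)).rank ≤
      Fintype.card (P.long j).In := fun j =>
    Matrix.rank_add_rank_le_card_of_mul_eq_zero (by
      ext r e
      exact (h3 r).2 ⟨j, e⟩)
  have h6 : P.b ≤ ∑ j, (Bj j).rank := by
    have h7 : M.rank ≤ _ := Matrix.rank_sum_le _ _
    rw [h4, Matrix.rank_one, Fintype.card_fin] at h7
    exact h7.trans (Finset.sum_le_sum fun j _ => Matrix.rank_mul_le_left _ _)
  have h8 := Finset.sum_le_sum fun j (_ : j ∈ Finset.univ) => h5 j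
  rw [Finset.sum_add_distrib] at h8
  omega

end Session

namespace Session

/-! ### Generic networks -/

/-- All transfer matrices have the rank given by the min cut. -/
def FullRank {F : Type} [Field F] {i : ℕ} (N : Fin i → Network)
    (a : ∀ j, Matrix (Fin (N j).edges) (Fin (N j).edges) F) : Prop :=
  ∀ j C, ((N j).transferQ (a j) C).rank = (N j).errorCut C

theorem FullRank.capacity_le {F : Type} [Field F] {i : ℕ} {N : Fin i → Network}
    {a : ∀ j, Matrix (Fin (N j).edges) (Fin (N j).edges) F} (h : FullRank N a) (j : Fin i) :
    (N j).capacity ≤ ((N j).transferT (a j)).rank := by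
  rw [← Network.rank_transferQ_outEdges, h]
  exact (N j).capacity_le_errorCut_outEdges

theorem prob_apply_le {i : ℕ} {M : Fin i → Type} [∀ j, AddGroup (M j)] [∀ j, Finite (M j)]
    (j : Fin i) {E : M j → Prop} {δ : ℝ} (h : prob E ≤ δ) :
    prob (fun a : ∀ j, M j => E (a j)) ≤ δ := by
  classical
  refine prob_le_of_resample (Γ := M j) (fun γ a => Pi.single j γ + a)
    (fun γ => add_right_injective _) fun a => ?_
  refine le_of_eq_of_le ?_ h
  rw [← prob_comp_equiv (Equiv.addRight (a j)) E]
  simp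

theorem exists_prob_not_fullRank_le {i : ℕ} (N : Fin i → Network) :
    ∃ c : ℕ, ∀ (F : Type) [Field F] [Fintype F],
      prob (fun a : ∀ j, Matrix (Fin (N j).edges) (Fin (N j).edges) F => ¬ FullRank N a) ≤
        c / Fintype.card F := by
  refine ⟨i * ∑ j, (2 ^ (N j).edges + 2) * ((N j).edges + 1), fun F _ _ => ?_⟩
  have h := prob_exists_le
    (fun (j : Fin i) (a : ∀ j, Matrix (Fin (N j).edges) (Fin (N j).edges) F) =>
      ¬ ∀ C, ((N j).transferQ (a j) C).rank = (N j).errorCut C)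
    (δ := (∑ j, (2 ^ (N j).edges + 2) * ((N j).edges + 1) : ℕ) / Fintype.card F) (by
      intro j
      refine prob_apply_le (M := fun j => Matrix (Fin (N j).edges) (Fin (N j).edges) F) j
        (E := fun a => ¬ ∀ C, ((N j).transferQ a C).rank = (N j).errorCut C)
        ((N j).prob_rank_transferQ_ne_le.trans ?_)
      gcongr
      exact Finset.single_le_sum (f := fun j => (2 ^ (N j).edges + 2) * ((N j).edges + 1))
        (fun _ _ => Nat.zero_le _) (Finset.mem_univ j))
  rw [Fintype.card_fin] at h
  refine (prob_mono ?_).trans (h.trans (le_of_eq ?_))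
  · intro a ha
    simpa [FullRank] using ha
  · push_cast
    ring

variable {P : Session} {F : Type} [Field F] {i : ℕ}

instance (P : Session) (F : Type) [Field F] (i : ℕ) : Nonempty (P.Coding F i) :=
  ⟨⟨0, 0, 0, 0⟩⟩

instance (P : Session) (F : Type) [Field F] (i : ℕ) : Nonempty (P.Secret F i) :=
  ⟨⟨0, 0⟩⟩

/-- Passage to a marginal: a random translation of one component leaves the others fixed. -/
theorem prob_aLong_le [Finite F]
    {E : (∀ j : Fin i, Matrix (Fin (P.long j).edges) (Fin (P.long j).edges) F) → Prop} {δ : ℝ}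
    (h : prob E ≤ δ) : prob (fun ω : P.Coding F i × P.Secret F i => E ω.1.aLong) ≤ δ := by
  refine prob_le_of_resample
    (Γ := ∀ j : Fin i, Matrix (Fin (P.long j).edges) (Fin (P.long j).edges) F)
    (fun γ ω => (⟨ω.1.K, ω.1.G, γ + ω.1.aLong, ω.1.aShort⟩, ω.2)) ?_ fun ω => ?_
  · rintro γ ⟨⟨K, G, a, a'⟩, s⟩ ⟨⟨K', G', b, b'⟩, s'⟩ hω
    simp only [Prod.mk.injEq, Coding.mk.injEq, add_right_inj] at hω
    obtain ⟨⟨rfl, rfl, rfl, rfl⟩, rfl⟩ := hω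
    rfl
  · refine le_of_eq_of_le ?_ h
    exact prob_comp_equiv (Equiv.addRight ω.1.aLong) E

theorem prob_aShort_le [Finite F]
    {E : (∀ j : Fin i, Matrix (Fin (P.short j).edges) (Fin (P.short j).edges) F) → Prop} {δ : ℝ}
    (h : prob E ≤ δ) : prob (fun ω : P.Coding F i × P.Secret F i => E ω.1.aShort) ≤ δ := by
  refine prob_le_of_resample
    (Γ := ∀ j : Fin i, Matrix (Fin (P.short j).edges) (Fin (P.short j).edges) F)
    (fun γ ω => (⟨ω.1.K, ω.1.G, ω.1.aLong, γ + ω.1.aShort⟩, ω.2)) ?_ fun ω => ?_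
  · rintro γ ⟨⟨K, G, a, a'⟩, s⟩ ⟨⟨K', G', b, b'⟩, s'⟩ hω
    simp only [Prod.mk.injEq, Coding.mk.injEq, add_right_inj] at hω
    obtain ⟨⟨rfl, rfl, rfl, rfl⟩, rfl⟩ := hω
    rfl
  · refine le_of_eq_of_le ?_ h
    exact prob_comp_equiv (Equiv.addRight ω.1.aShort) E

/-- Conditioning on the network coefficients: only `K` is resampled. -/
theorem prob_aLong_K_le [Finite F]
    {E : (∀ j : Fin i, Matrix (Fin (P.long j).edges) (Fin (P.long j).edges) F) →
      (∀ j : Fin i, Matrix (P.long j).Out (Fin P.b) F) → Prop} {δ : ℝ}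
    (h : ∀ a, prob (E a) ≤ δ) :
    prob (fun ω : P.Coding F i × P.Secret F i => E ω.1.aLong ω.1.K) ≤ δ := by
  refine prob_le_of_resample (Γ := ∀ j : Fin i, Matrix (P.long j).Out (Fin P.b) F)
    (fun γ ω => (⟨γ + ω.1.K, ω.1.G, ω.1.aLong, ω.1.aShort⟩, ω.2)) ?_ fun ω => ?_
  · rintro γ ⟨⟨K, G, a, a'⟩, s⟩ ⟨⟨K', G', b, b'⟩, s'⟩ hω
    simp only [Prod.mk.injEq, Coding.mk.injEq, add_right_inj] at hω
    obtain ⟨⟨rfl, rfl, rfl, rfl⟩, rfl⟩ := hω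
    rfl
  · refine le_of_eq_of_le ?_ (h ω.1.aLong)
    exact prob_comp_equiv (Equiv.addRight ω.1.K) (E ω.1.aLong)

theorem prob_aShort_G_le [Finite F]
    {E : (∀ j : Fin i, Matrix (Fin (P.short j).edges) (Fin (P.short j).edges) F) →
      (∀ j : Fin i, Matrix (P.short j).Out (Fin (j + 1) × Fin P.σ) F) → Prop} {δ : ℝ}
    (h : ∀ a, prob (E a) ≤ δ) :
    prob (fun ω : P.Coding F i × P.Secret F i => E ω.1.aShort ω.1.G) ≤ δ := by
  refine prob_le_of_resample (Γ := ∀ j : Fin i, Matrix (P.short j).Out (Fin (j + 1) × Fin P.σ) F)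
    (fun γ ω => (⟨ω.1.K, γ + ω.1.G, ω.1.aLong, ω.1.aShort⟩, ω.2)) ?_ fun ω => ?_
  · rintro γ ⟨⟨K, G, a, a'⟩, s⟩ ⟨⟨K', G', b, b'⟩, s'⟩ hω
    simp only [Prod.mk.injEq, Coding.mk.injEq, add_right_inj] at hω
    obtain ⟨⟨rfl, rfl, rfl, rfl⟩, rfl⟩ := hω
    rfl
  · refine le_of_eq_of_le ?_ (h ω.1.aShort)
    exact prob_comp_equiv (Equiv.addRight ω.1.G) (E ω.1.aShort)

/-! ### Alice's random matrices -/

/-- `T` maps the preimage into the range of `Q`, with kernel inside that of `T`. The preimage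
consists of the inputs of Alice whose effect Calvin can imitate. -/
theorem finrank_comap_range_add_rank_le {m n κ : Type} [Fintype m] [Fintype n] [Fintype κ]
    (T : Matrix m n F) (Q : Matrix m κ F) :
    Module.finrank F ((LinearMap.range Q.mulVecLin).comap T.mulVecLin) + T.rank ≤
      Fintype.card n + Q.rank := by
  set S := (LinearMap.range Q.mulVecLin).comap T.mulVecLin
  have h1 := LinearMap.finrank_range_add_finrank_ker (T.mulVecLin.domRestrict S)
  have h2 : Module.finrank F (LinearMap.range (T.mulVecLin.domRestrict S)) ≤ Q.rank := by
    refine Submodule.finrank_mono ?_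
    rintro _ ⟨⟨v, hv⟩, rfl⟩
    exact hv
  have h3 : Module.finrank F (LinearMap.ker (T.mulVecLin.domRestrict S)) ≤
      Module.finrank F (LinearMap.ker T.mulVecLin) := by
    refine LinearMap.finrank_le_finrank_of_injective
      (f := S.subtype.restrict (p := LinearMap.ker (T.mulVecLin.domRestrict S))
        (q := LinearMap.ker T.mulVecLin) fun x hx => hx) ?_
    intro x y hxy
    have h := congrArg Subtype.val hxy
    exact Subtype.ext (Subtype.ext h)
  have h4 := T.rank_add_nullity
  omega

theorem mulVec_surjective_of_ne_zero {m n : Type} [Fintype n] {v : n → F} (hv : v ≠ 0)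
    (u : m → F) : ∃ K : Matrix m n F, K *ᵥ v = u := by
  classical
  obtain ⟨s, hs⟩ := Function.ne_iff.1 hv
  refine ⟨Matrix.vecMulVec u (Pi.single s (v s)⁻¹), ?_⟩
  rw [Matrix.vecMulVec_mulVec, single_dotProduct, inv_mul_cancel₀ hs]
  simp

theorem natCard_fun_eq_pow (F κ : Type) [Fintype κ] :
    Nat.card (κ → F) = Nat.card F ^ Fintype.card κ := by
  rw [Nat.card_fun, Nat.card_eq_fintype_card (α := κ)]

theorem one_div_card_sub_one_le [Fintype F] :
    (1 : ℝ) / (Fintype.card F - 1) ≤ 2 / Fintype.card F := by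
  have h : (2 : ℝ) ≤ Fintype.card F := by exact_mod_cast Fintype.one_lt_card (α := F)
  rw [div_le_div_iff₀ (by linarith) (by linarith)]
  linarith

/-- A failure needs a `v ≠ 0` such that every `K_j v` can be imitated by Calvin. All families `C`
are admitted, as Calvin picks his places knowing `K`; their number, independent of `q`, enters the
constant. -/
theorem exists_prob_long_not_separated_le (P : Session) (z : ℕ → ℕ) (i : ℕ)
    (hcap : P.b + ∑ j : Fin i, z j ≤ ∑ j : Fin i, (P.long j).capacity) :
    ∃ c : ℕ, ∀ (F : Type) [Field F] [Fintype F],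
      prob (fun ω : P.Coding F i × P.Secret F i =>
        FullRank (fun j : Fin i => P.long j) ω.1.aLong ∧
        ∃ C : ∀ j : Fin i, Finset (Fin (P.long j).edges),
          (∀ j : Fin i, (P.long j).errorCut (C j) = z j) ∧
          ∃ v, v ≠ 0 ∧ ∀ j : Fin i, (P.long j).transferT (ω.1.aLong j) *ᵥ (ω.1.K j *ᵥ v) ∈
            LinearMap.range ((P.long j).transferQ (ω.1.aLong j) (C j)).mulVecLin) ≤
        c / Fintype.card F := by
  classical
  refine ⟨Fintype.card (∀ j : Fin i, Finset (Fin (P.long j).edges)) * 2, fun F _ _ => ?_⟩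
  refine prob_aLong_K_le (E := fun a K => FullRank (fun j : Fin i => P.long j) a ∧
        ∃ C : ∀ j : Fin i, Finset (Fin (P.long j).edges),
          (∀ j : Fin i, (P.long j).errorCut (C j) = z j) ∧
          ∃ v, v ≠ 0 ∧ ∀ j : Fin i, (P.long j).transferT (a j) *ᵥ (K j *ᵥ v) ∈
            LinearMap.range ((P.long j).transferQ (a j) (C j)).mulVecLin) fun a => ?_
  have hpos : (0 : ℝ) ≤ 2 / Fintype.card F := by positivity
  have key : ∀ C : ∀ j : Fin i, Finset (Fin (P.long j).edges),
      prob (fun K : ∀ j : Fin i, Matrix (P.long j).Out (Fin P.b) F =>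
        FullRank (fun j : Fin i => P.long j) a ∧ (∀ j : Fin i, (P.long j).errorCut (C j) = z j) ∧
          ∃ v, v ≠ 0 ∧ ∀ j : Fin i, (P.long j).transferT (a j) *ᵥ (K j *ᵥ v) ∈
            LinearMap.range ((P.long j).transferQ (a j) (C j)).mulVecLin) ≤
      2 / Fintype.card F := by
    intro C
    by_cases ha : FullRank (fun j : Fin i => P.long j) a
    swap
    · simpa [ha, prob_false] using hpos
    by_cases hC : ∀ j : Fin i, (P.long j).errorCut (C j) = z j
    swap
    · simpa [hC, prob_false] using hpos
    -- The codimensions add up over the stages, to at least `∑ (M_j - z_j) ≥ b`.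
    let S : Submodule F (∀ j : Fin i, (P.long j).Out → F) := Submodule.pi Set.univ fun j =>
      (LinearMap.range ((P.long j).transferQ (a j) (C j)).mulVecLin).comap
        ((P.long j).transferT (a j)).mulVecLin
    have hd : ∀ j : Fin i, Module.finrank F ((LinearMap.range
        ((P.long j).transferQ (a j) (C j)).mulVecLin).comap
        ((P.long j).transferT (a j)).mulVecLin) + (P.long j).capacity ≤
        Fintype.card (P.long j).Out + z j := by
      intro j
      have h1 := finrank_comap_range_add_rank_le ((P.long j).transferT (a j))
        ((P.long j).transferQ (a j) (C j))
      have h2 := ha.capacity_le j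
      have h3 := ha j (C j)
      have h4 := hC j
      dsimp only at h2 h3
      omega
    have hS : Nat.card S * Nat.card (Fin P.b → F) ≤
        Nat.card (∀ j : Fin i, (P.long j).Out → F) := by
      have e : S ≃ ∀ j : Fin i, ((LinearMap.range
          ((P.long j).transferQ (a j) (C j)).mulVecLin).comap
          ((P.long j).transferT (a j)).mulVecLin) :=
        { toFun := fun x j => ⟨x.1 j, x.2 j trivial⟩
          invFun := fun x => ⟨fun j => (x j).1, fun j _ => (x j).2⟩
          left_inv := fun x => rfl
          right_inv := fun x => rfl }
      rw [Nat.card_congr e, natCard_fun_eq_pow F (Fin P.b), Nat.card_pi, Nat.card_pi,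
        Fintype.card_fin,
        Finset.prod_congr rfl fun j _ => Module.natCard_eq_pow_finrank (K := F),
        Finset.prod_congr rfl fun (j : Fin i) _ => natCard_fun_eq_pow F (P.long j).Out]
      rw [Finset.prod_pow_eq_pow_sum, Finset.prod_pow_eq_pow_sum, ← pow_add]
      refine Nat.pow_le_pow_right Nat.card_pos ?_
      have h1 := Finset.sum_le_sum fun j (_ : j ∈ Finset.univ) => hd j
      rw [Finset.sum_add_distrib, Finset.sum_add_distrib] at h1
      omega
    have h := prob_exists_mem_le (F := F) (V := Fin P.b → F)
      (Ω := ∀ j : Fin i, Matrix (P.long j).Out (Fin P.b) F)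
      (U := ∀ j : Fin i, (P.long j).Out → F)
      (fun v => AddMonoidHom.mk' (fun K j => K j *ᵥ v) fun K K' => by
        ext j x
        exact congrFun (Matrix.add_mulVec (K j) (K' j) v) x)
      (by
        intro v hv u
        choose K hK using fun j => mulVec_surjective_of_ne_zero hv (u j)
        exact ⟨K, funext hK⟩)
      (by
        intro t v K
        ext j x
        exact congrFun (Matrix.mulVec_smul (K j) t v) x) S hS
    refine (prob_mono ?_).trans (h.trans one_div_card_sub_one_le)
    rintro K ⟨-, -, v, hv, hmem⟩
    exact ⟨v, hv, fun j _ => hmem j⟩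
  refine (prob_mono ?_).trans ((prob_exists_le _ key).trans (le_of_eq ?_))
  · rintro K ⟨ha, C, hC, hv⟩
    exact ⟨C, ha, hC, hv⟩
  · push_cast
    ring

/-- The argument for long packets, applied to single stages and to vectors in the last block, where
codimension `σ` suffices. -/
theorem exists_prob_short_not_separated_le (P : Session) (zs : ℕ → ℕ) (i : ℕ)
    (hcap : ∀ j, P.σ + zs j ≤ (P.short j).capacity) :
    ∃ c : ℕ, ∀ (F : Type) [Field F] [Fintype F],
      prob (fun ω : P.Coding F i × P.Secret F i =>
        FullRank (fun j : Fin i => P.short j) ω.1.aShort ∧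
        ∃ (j : Fin i) (C : Finset (Fin (P.short j).edges)),
          (P.short j).errorCut C = zs j ∧
          ∃ v, v ≠ 0 ∧ (P.short j).transferT (ω.1.aShort j) *ᵥ (ω.1.G j *ᵥ P.lastBlock j v) ∈
            LinearMap.range ((P.short j).transferQ (ω.1.aShort j) C).mulVecLin) ≤
        c / Fintype.card F := by
  classical
  refine ⟨Fintype.card (Σ j : Fin i, Finset (Fin (P.short j).edges)) * 2, fun F _ _ => ?_⟩
  refine prob_aShort_G_le (E := fun a G => FullRank (fun j : Fin i => P.short j) a ∧
        ∃ (j : Fin i) (C : Finset (Fin (P.short j).edges)),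
          (P.short j).errorCut C = zs j ∧
          ∃ v, v ≠ 0 ∧ (P.short j).transferT (a j) *ᵥ (G j *ᵥ P.lastBlock j v) ∈
            LinearMap.range ((P.short j).transferQ (a j) C).mulVecLin) fun a => ?_
  have hpos : (0 : ℝ) ≤ 2 / Fintype.card F := by positivity
  have key : ∀ C : (Σ j : Fin i, Finset (Fin (P.short j).edges)),
      prob (fun G : ∀ j : Fin i, Matrix (P.short j).Out (Fin (j + 1) × Fin P.σ) F =>
        FullRank (fun j : Fin i => P.short j) a ∧ (P.short C.1).errorCut C.2 = zs C.1 ∧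
          ∃ v, v ≠ 0 ∧ (P.short C.1).transferT (a C.1) *ᵥ (G C.1 *ᵥ P.lastBlock C.1 v) ∈
            LinearMap.range ((P.short C.1).transferQ (a C.1) C.2).mulVecLin) ≤
      2 / Fintype.card F := by
    rintro ⟨j, C⟩
    by_cases ha : FullRank (fun j : Fin i => P.short j) a
    swap
    · simpa [ha, prob_false] using hpos
    by_cases hC : (P.short j).errorCut C = zs j
    swap
    · simpa [hC, prob_false] using hpos
    let S : Submodule F ((P.short j).Out → F) :=
      (LinearMap.range ((P.short j).transferQ (a j) C).mulVecLin).comap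
        ((P.short j).transferT (a j)).mulVecLin
    have hS : Nat.card S * Nat.card (Fin P.σ → F) ≤ Nat.card ((P.short j).Out → F) := by
      rw [Module.natCard_eq_pow_finrank (K := F) (V := S), natCard_fun_eq_pow, natCard_fun_eq_pow,
        Fintype.card_fin, ← pow_add]
      refine Nat.pow_le_pow_right Nat.card_pos ?_
      have h1 := finrank_comap_range_add_rank_le ((P.short j).transferT (a j))
        ((P.short j).transferQ (a j) C)
      have h2 := ha.capacity_le j
      have h3 := ha j C
      have h4 := hcap j
      dsimp only at h2 h3
      change Module.finrank F S + _ ≤ _ at h1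
      omega
    have hinj : ∀ v : Fin P.σ → F, v ≠ 0 → P.lastBlock j v ≠ 0 := by
      intro v hv h0
      refine hv (funext fun s => ?_)
      simpa [lastBlock] using congrFun h0 (Fin.last j, s)
    have h := prob_exists_mem_le (F := F) (V := Fin P.σ → F)
      (Ω := ∀ j : Fin i, Matrix (P.short j).Out (Fin (j + 1) × Fin P.σ) F)
      (U := (P.short j).Out → F)
      (fun v => AddMonoidHom.mk' (fun G => G j *ᵥ P.lastBlock j v) fun G G' =>
        Matrix.add_mulVec (G j) (G' j) _)
      (by
        intro v hv u
        obtain ⟨G, hG⟩ := mulVec_surjective_of_ne_zero (hinj v hv) u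
        refine ⟨Pi.single j G, ?_⟩
        have h5 : (Pi.single j G : ∀ j : Fin i, Matrix (P.short j).Out (Fin (j + 1) × Fin P.σ) F) j
            = G :=
          Pi.single_eq_same (M := fun j : Fin i => Matrix (P.short j).Out (Fin (j + 1) × Fin P.σ) F)
            j G
        exact (congrArg (· *ᵥ P.lastBlock j v) h5).trans hG)
      (by
        intro t v G
        have h5 : P.lastBlock j (t • v) = t • P.lastBlock j v := by
          ext r
          simp [lastBlock]
        simp only [AddMonoidHom.mk'_apply, h5]
        exact Matrix.mulVec_smul (G j) t _) S hS
    refine (prob_mono ?_).trans (h.trans one_div_card_sub_one_le)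
    rintro G ⟨-, -, v, hv, hmem⟩
    exact ⟨v, hv, hmem⟩
  refine (prob_mono ?_).trans ((prob_exists_le _ key).trans (le_of_eq ?_))
  · rintro G ⟨ha, j, C, hC, hv⟩
    exact ⟨⟨j, C⟩, ha, hC, hv⟩
  · push_cast
    ring

end Session

namespace Session

variable {P : Session} {F : Type} [Field F] {i : ℕ}

/-! ### The hash symbols -/

/-- The total number of hash symbols of the first `i` stages. -/
abbrev AllHashIdx (P : Session) (i : ℕ) : Type := Σ k : Fin i, P.HashIdx k

theorem two_mul_card_allHashIdx (P : Session) (i : ℕ) :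
    2 * Fintype.card (P.AllHashIdx i) = P.σ * P.m * (i * (i + 1)) := by
  have h : Fintype.card (P.AllHashIdx i) = ∑ k ∈ Finset.range i, P.σ * ((k + 1) * P.m) := by
    rw [Fintype.card_sigma, Finset.sum_range]
    simp
  rw [h]
  induction i with
  | zero => simp
  | succ i ih =>
    rw [Finset.sum_range_succ, mul_add, ih (by simp [Fintype.card_sigma, Finset.sum_range])]
    ring

/-- The polynomial whose values are the parity checks of `y`. -/
def parityPoly (P : Session) (y : Fin P.n × Fin P.b → F) : Polynomial F :=
  ∑ p, Polynomial.monomial ((finProdFinEquiv p : ℕ) + 1) (y p)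

theorem parity_mulVec {k : ℕ} (d : P.HashIdx k → F) (y : Fin P.n × Fin P.b → F)
    (u : P.HashIdx k) : (P.parity d *ᵥ y) u = (P.parityPoly y).eval (d u) := by
  rw [parityPoly, Polynomial.eval_finsetSum]
  simp only [Matrix.mulVec, dotProduct, parity, Polynomial.eval_monomial]
  exact Finset.sum_congr rfl fun p _ => mul_comm _ _

theorem coeff_parityPoly (y : Fin P.n × Fin P.b → F) (p : Fin P.n × Fin P.b) :
    (P.parityPoly y).coeff ((finProdFinEquiv p : ℕ) + 1) = y p := by
  rw [parityPoly, Polynomial.finsetSum_coeff, Finset.sum_eq_single p]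
  · simp
  · intro p' _ hp
    rw [Polynomial.coeff_monomial, if_neg]
    intro h
    exact hp (finProdFinEquiv.injective (Fin.ext (by omega)))
  · simp

/-- The exponents start at `1`, so subtracting a constant cannot annihilate the polynomial; its
degree bounds the number of roots. -/
theorem card_filter_eval_parityPoly_le [Fintype F] [DecidableEq F] {y : Fin P.n × Fin P.b → F}
    (hy : y ≠ 0) (t : F) :
    (Finset.univ.filter fun x => (P.parityPoly y).eval x = t).card ≤ P.n * P.b := by
  obtain ⟨p, hp⟩ := Function.ne_iff.1 hy
  have h0 : P.parityPoly y - Polynomial.C t ≠ 0 := by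
    intro h
    have h1 := congrArg (fun f => Polynomial.coeff f ((finProdFinEquiv p : ℕ) + 1)) h
    simp only [Polynomial.coeff_sub, coeff_parityPoly, Polynomial.coeff_C_succ, sub_zero,
      Polynomial.coeff_zero] at h1
    exact hp h1
  have hdeg : (P.parityPoly y - Polynomial.C t).natDegree ≤ P.n * P.b := by
    rw [Polynomial.natDegree_sub_C]
    refine Polynomial.natDegree_sum_le_of_forall_le _ _ fun p _ => ?_
    exact (Polynomial.natDegree_monomial_le _).trans (finProdFinEquiv p).2
  refine le_trans ?_ ((Polynomial.card_roots' _).trans hdeg)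
  refine le_trans (Finset.card_le_card ?_) (Multiset.toFinset_card_le _)
  intro x hx
  rw [Multiset.mem_toFinset, Polynomial.mem_roots h0]
  simpa [sub_eq_zero] using hx

/-- Two different messages are confused by all hash symbols with small probability only. -/
theorem prob_parity_eq_le [Fintype F] {y : Fin P.n × Fin P.b → F} (hy : y ≠ 0)
    (t : P.Suffixes F i) :
    prob (fun d : ∀ k : Fin i, P.HashIdx k → F => ∀ k, P.parity (d k) *ᵥ y = t k) ≤
      ((P.n * P.b : ℕ) : ℝ) ^ Fintype.card (P.AllHashIdx i) /
        (Fintype.card F : ℝ) ^ Fintype.card (P.AllHashIdx i) := by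
  classical
  rw [← prob_comp_equiv (Equiv.piCurry fun (k : Fin i) (_ : P.HashIdx k) => F)]
  have h1 : prob (fun x : P.AllHashIdx i → F => ∀ k,
      P.parity (Equiv.piCurry (fun (k : Fin i) (_ : P.HashIdx k) => F) x k) *ᵥ y = t k) ≤
      prob (fun x : P.AllHashIdx i → F => x ∈ Fintype.piFinset fun u : P.AllHashIdx i =>
        Finset.univ.filter fun a => (P.parityPoly y).eval a = t u.1 u.2) := by
    refine prob_mono fun x hx => ?_
    rw [Fintype.mem_piFinset]
    intro u
    have := congrFun (hx u.1) u.2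
    rw [parity_mulVec] at this
    exact Finset.mem_filter.2 ⟨Finset.mem_univ _, this⟩
  refine h1.trans ?_
  rw [prob, Nat.card_eq_fintype_card, Fintype.card_coe, Fintype.card_piFinset,
    Nat.card_eq_fintype_card, Fintype.card_fun]
  push_cast
  gcongr
  have h2 := Finset.prod_le_prod' (s := Finset.univ) fun (u : P.AllHashIdx i) _ =>
    card_filter_eval_parityPoly_le hy (t u.1 u.2)
  rw [Finset.prod_const, Finset.card_univ] at h2
  exact_mod_cast h2

/-- Counts the candidate messages and the candidate suffixes that the received row spaces allow. -/
theorem card_filter_forall_mem_le {ι κ V : Type} [Fintype ι] [Fintype κ] [Finite F]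
    (S : Submodule F (κ → F)) (s : Finset V) (f : V → ι → κ → F) (hf : Function.Injective f)
    (hs : ∀ x ∈ s, ∀ r, f x r ∈ S) :
    s.card ≤ Nat.card F ^ (Module.finrank F S * Fintype.card ι) := by
  have h1 : Nat.card (ι → S) = Nat.card F ^ (Module.finrank F S * Fintype.card ι) := by
    rw [natCard_fun_eq_pow, Module.natCard_eq_pow_finrank (K := F) (V := S), ← pow_mul]
  rw [← h1, ← Nat.card_eq_finsetCard s]
  refine Nat.card_le_card_of_injective (fun x r => (⟨f x.1 r, hs x.1 x.2 r⟩ : S)) ?_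
  intro x x' hx
  refine Subtype.ext (hf ?_)
  ext r : 1
  exact congrArg Subtype.val (congrFun hx r)

/-- The exponents in the union bound. -/
theorem exponent_lt (P : Session) (cbar : ℕ) (hm : 2 * P.b * cbar + 2 * P.σ * cbar + 1 ≤ P.σ * P.m)
    {i : ℕ} (hi : i ≠ 0) :
    i * (2 * cbar) * P.b + i * cbar * (i * P.σ) + 1 ≤ Fintype.card (P.AllHashIdx i) := by
  have h1 := P.two_mul_card_allHashIdx i
  have h2 := Nat.mul_le_mul_right (i * (i + 1)) hm
  rw [← h1] at h2
  have h3 : 1 ≤ i := Nat.one_le_iff_ne_zero.2 hi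
  -- Multiplied by `i * (i + 1)`, the three terms of `hm` dominate twice the three terms of the
  -- goal, one by one. The final `1` is the gap that yields the factor `1 / q`.
  have h4 : 2 ≤ i * (i + 1) := by nlinarith
  have h5 : 2 * i * (P.b * cbar) ≤ i * (i + 1) * (P.b * cbar) :=
    Nat.mul_le_mul_right _ (by nlinarith)
  nlinarith [Nat.zero_le (P.σ * cbar * i)]

theorem X0_injective (P : Session) : Function.Injective (P.X0 (F := F)) := by
  intro W W' h
  ext r x
  exact congrFun (congrFun h r) (Sum.inl x)

theorem suffixMatrix_injective (P : Session) :
    Function.Injective (P.suffixMatrix (F := F) (k := i)) := by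
  intro l l' h
  ext k u
  have h1 : P.suffixPart l = P.suffixPart l' := by
    ext r c
    exact congrFun (congrFun h r) (Sum.inl c)
  rw [← vec_suffixPart_hashPos l ⟨k, u⟩, h1, vec_suffixPart_hashPos]

/-- Resampling of the secret that keeps the suffixes of the message `W`. -/
def resample (W : P.Message F) (γ : ∀ k : Fin i, P.HashIdx k → F)
    (ω : P.Coding F i × P.Secret F i) : P.Coding F i × P.Secret F i :=
  (ω.1, ⟨γ + ω.2.d,
    fun k => P.suffix ω.2 W k + P.parity (γ k + ω.2.d k) *ᵥ Matrix.vec W⟩)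

/-- Calvin sees the secret only through these suffixes, so everything Bob receives is constant along
the orbit while `d` becomes uniform. -/
theorem suffix_resample (W : P.Message F) (γ : ∀ k : Fin i, P.HashIdx k → F)
    (ω : P.Coding F i × P.Secret F i) :
    P.suffix (resample W γ ω).2 W = P.suffix ω.2 W := by
  ext k u
  simp [suffix, resample]

/-- For fixed `W`, the secret is determined by `d` and the suffixes, because `h = l + D w`. -/
theorem resample_injective (W : P.Message F) (γ : ∀ k : Fin i, P.HashIdx k → F) :
    Function.Injective (resample W γ) := by
  intro ω ω' h
  have h1 := congrArg (fun ω => P.suffix ω.2 W) h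
  simp only [suffix_resample] at h1
  obtain ⟨c, d, e⟩ := ω
  obtain ⟨c', d', e'⟩ := ω'
  simp only [resample, Prod.mk.injEq, Secret.mk.injEq, add_right_inj] at h
  obtain ⟨rfl, rfl, -⟩ := h
  have : e = e' := by
    ext k u
    have h2 := congrFun (congrFun h1 k) u
    simpa [suffix] using h2
  rw [this]

/-- With high probability, Bob considers no wrong message as possible. -/
theorem prob_exists_plausible_ne_le [Fintype F] (P : Session) {cbar : ℕ} {z zs : ℕ → ℕ}
    (hc : ∀ j, Fintype.card (P.long j).Out ≤ cbar) (hz : ∀ j, z j ≤ cbar)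
    (hσ : ∀ j, P.σ + zs j ≤ cbar)
    (hm : 2 * P.b * cbar + 2 * P.σ * cbar + 1 ≤ P.σ * P.m) (W : P.Message F)
    (A : P.Calvin F i) (hA : A.HasCuts z zs) :
    prob (fun ω : P.Coding F i × P.Secret F i => ∃ W', W' ≠ W ∧ P.Plausible W A ω W') ≤
      ((P.n * P.b) ^ Fintype.card (P.AllHashIdx i) : ℕ) / Fintype.card F := by
  classical
  -- Without hash symbols `exponent_lt` fails, but then Bob has no rows, and no row of `(W' I)` is
  -- zero.
  rcases Nat.eq_zero_or_pos i with rfl | hi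
  · refine (prob_mono (E' := fun _ => False) ?_).trans ?_
    · rintro ω ⟨W', hW', h, -⟩
      refine hW' (Matrix.ext fun r => ?_)
      obtain ⟨w, hw⟩ := mem_rowSpace_iff.1 (h r)
      have h1 := congrFun hw (Sum.inr r)
      have h2 : P.X0 W' r (Sum.inr r) = 1 := by simp [X0]
      rw [h2] at h1
      simp [Matrix.vecMul, dotProduct] at h1
    · rw [prob_false]
      positivity
  have hq : (0 : ℝ) < Fintype.card F := by exact_mod_cast Fintype.card_pos
  have hq1 : (1 : ℝ) ≤ Fintype.card F := by exact_mod_cast Fintype.card_pos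
  set H := Fintype.card (P.AllHashIdx i) with hH
  refine prob_le_of_resample (Γ := ∀ k : Fin i, P.HashIdx k → F) (resample W)
    (resample_injective W) fun ω => ?_
  set l := P.suffix ω.2 W with hl
  set Y := P.recvLong W A ω.1 l with hY
  set J := P.recvShort A ω.1 l with hJ
  have := Fintype.ofFinite (P.Message F)
  have := Fintype.ofFinite (P.Suffixes F i)
  let S₁ : Finset (P.Message F) :=
    Finset.univ.filter fun W' => W' ≠ W ∧ ∀ r, P.X0 W' r ∈ rowSpace Y
  let S₂ : Finset (P.Suffixes F i) :=
    Finset.univ.filter fun l' => ∀ r, P.suffixMatrix l' r ∈ rowSpace J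
  have hS₁ : S₁.card ≤ Fintype.card F ^ (i * (2 * cbar) * P.b) := by
    refine (card_filter_forall_mem_le (rowSpace Y) S₁ P.X0 P.X0_injective
      fun x hx => (Finset.mem_filter.1 hx).2.2).trans ?_
    rw [Nat.card_eq_fintype_card, Fintype.card_fin]
    refine Nat.pow_le_pow_right Fintype.card_pos (Nat.mul_le_mul_right _ ?_)
    refine (finrank_rowSpace_recvLong_le W A ω.1 l).trans ?_
    refine (Finset.sum_le_card_nsmul _ _ (2 * cbar) fun j _ => ?_).trans (by simp)
    have h1 := hc j
    have h2 := hz j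
    have h3 := (hA ω.1 l j).1
    omega
  have hS₂ : S₂.card ≤ Fintype.card F ^ (i * cbar * (i * P.σ)) := by
    refine (card_filter_forall_mem_le (rowSpace J) S₂ P.suffixMatrix P.suffixMatrix_injective
      fun x hx => (Finset.mem_filter.1 hx).2).trans ?_
    rw [Nat.card_eq_fintype_card, Fintype.card_prod, Fintype.card_fin, Fintype.card_fin]
    refine Nat.pow_le_pow_right Fintype.card_pos (Nat.mul_le_mul_right _ ?_)
    refine (finrank_rowSpace_recvShort_le A ω.1 l).trans ?_
    -- Distributing the `i * σ` true rows over the stages bounds each stage by `σ + zs j ≤ cbar`.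
    have h1 : i * P.σ = ∑ _j : Fin i, P.σ := by simp
    rw [h1, ← Finset.sum_add_distrib]
    refine (Finset.sum_le_card_nsmul _ _ cbar fun j _ => ?_).trans (by simp)
    have h2 := hσ j
    have h3 := (hA ω.1 l j).2
    omega
  -- Both messages share `h`: from `l + D w = h = l' + D w'` follows `D (w - w') = l' - l`, where
  -- `l` is fixed and `(w', l')` runs through the candidates.
  have hunion := prob_exists_finset_le (Ω := ∀ k : Fin i, P.HashIdx k → F) (S₁ ×ˢ S₂)
    (fun p d => ∀ k, P.parity (d k) *ᵥ (Matrix.vec W - Matrix.vec p.1) = (p.2 - l) k)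
    (fun p hp => prob_parity_eq_le (by
      rw [sub_ne_zero]
      intro h
      exact (Finset.mem_filter.1 (Finset.mem_product.1 hp).1).2.1 (Matrix.vec_inj.1 h).symm) _)
  rw [← prob_comp_equiv (Equiv.addRight ω.2.d)] at hunion
  refine (prob_mono ?_).trans (hunion.trans ?_)
  · rintro γ ⟨W', hne, hW1, hW2⟩
    rw [suffix_resample] at hW1 hW2
    refine ⟨(W', P.suffix (resample W γ ω).2 W'), ?_, fun k => ?_⟩
    · rw [Finset.mem_product]
      exact ⟨Finset.mem_filter.2 ⟨Finset.mem_univ _, hne, hW1⟩,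
        Finset.mem_filter.2 ⟨Finset.mem_univ _, hW2⟩⟩
    · rw [Matrix.mulVec_sub, Pi.sub_apply]
      change _ = (P.suffix ω.2 W k + P.parity (γ k + ω.2.d k) *ᵥ Matrix.vec W) -
        P.parity (γ k + ω.2.d k) *ᵥ Matrix.vec W' - P.suffix ω.2 W k
      simp only [Equiv.coe_addRight, Pi.add_apply]
      abel
  · rw [Finset.card_product]
    have h1 : S₁.card * S₂.card * Fintype.card F ≤ Fintype.card F ^ H := by
      calc S₁.card * S₂.card * Fintype.card F ≤
          Fintype.card F ^ (i * (2 * cbar) * P.b) * Fintype.card F ^ (i * cbar * (i * P.σ)) *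
            Fintype.card F := by gcongr
        _ = Fintype.card F ^ (i * (2 * cbar) * P.b + i * cbar * (i * P.σ) + 1) := by
          rw [pow_succ, pow_add]
        _ ≤ _ := Nat.pow_le_pow_right Fintype.card_pos (P.exponent_lt cbar hm hi.ne')
    have h2 : ((S₁.card * S₂.card : ℕ) : ℝ) * Fintype.card F ≤ (Fintype.card F : ℝ) ^ H := by
      exact_mod_cast h1
    rw [← mul_div_assoc, div_le_div_iff₀ (by positivity) hq, ← Nat.cast_pow]
    calc _ = (((P.n * P.b) ^ H : ℕ) : ℝ) * (((S₁.card * S₂.card : ℕ) : ℝ) * Fintype.card F) := by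
          ring
      _ ≤ _ := by gcongr

end Session

end

/-! ### Assembling the estimates -/

theorem mainTheorem3 (P : Session) (cbar : ℕ) (z zs : ℕ → ℕ)
    (hc : ∀ j, Fintype.card (P.long j).Out ≤ cbar)
    (hcs : ∀ j, Fintype.card (P.short j).Out ≤ cbar)
    (hz : ∀ j, z j < (P.long j).capacity)
    (hzs : ∀ j, zs j < (P.short j).capacity)
    (hσ : ∀ j, P.σ + zs j ≤ (P.short j).capacity)
    (hm : 2 * P.b * cbar + 2 * P.σ * cbar + 1 ≤ P.σ * P.m)
    (i : ℕ) (ε : ℝ) (hε : 0 < ε) :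
    ∃ q₀ : ℕ, ∀ (F : Type) [Field F] [Fintype F], q₀ ≤ Fintype.card F →
      ∀ (W : P.Message F) (A : P.Calvin F i) (sel : P.Selection F i), A.HasCuts z zs →
        (P.b + ∑ j ∈ Finset.range i, z j ≤ ∑ j ∈ Finset.range i, (P.long j).capacity →
          1 - ε ≤ prob fun ω : P.Coding F i × P.Secret F i =>
            P.result W A sel ω = Outcome.decoded (P.X0 W)) ∧
        (∑ j ∈ Finset.range i, (P.long j).capacity < P.b + ∑ j ∈ Finset.range i, z j →
          1 - ε ≤ prob fun ω : P.Coding F i × P.Secret F i =>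
            P.result W A sel ω = Outcome.wait ∨
              P.result W A sel ω = Outcome.decoded (P.X0 W)) ∧
        (∑ j ∈ Finset.range i, Fintype.card (P.long j).In <
            P.b + ∑ j ∈ Finset.range i, z j →
          1 - ε ≤ prob fun ω : P.Coding F i × P.Secret F i =>
            A.GenuineErrors W ω.1 (P.suffix ω.2 W) → P.result W A sel ω = Outcome.wait) := by
  have hcap : ∀ j, (P.long j).capacity ≤ cbar := fun j =>
    (P.long j).capacity_le_card_out.trans (hc j)
  have hcaps : ∀ j, (P.short j).capacity ≤ cbar := fun j =>
    (P.short j).capacity_le_card_out.trans (hcs j)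
  obtain ⟨c₁, h₁⟩ := Session.exists_prob_not_fullRank_le fun j : Fin i => P.long j
  obtain ⟨c₂, h₂⟩ := Session.exists_prob_not_fullRank_le fun j : Fin i => P.short j
  obtain ⟨c₃, h₃⟩ := Session.exists_prob_short_not_separated_le P zs i hσ
  -- One `q₀` has to serve all three claims, so a constant is also fixed when the capacity condition
  -- fails.
  obtain ⟨c₄, h₄⟩ : ∃ c : ℕ, P.b + ∑ j : Fin i, z j ≤ ∑ j : Fin i, (P.long j).capacity →
      ∀ (F : Type) [Field F] [Fintype F],
      prob (fun ω : P.Coding F i × P.Secret F i =>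
        Session.FullRank (fun j : Fin i => P.long j) ω.1.aLong ∧
        ∃ C : ∀ j : Fin i, Finset (Fin (P.long j).edges),
          (∀ j : Fin i, (P.long j).errorCut (C j) = z j) ∧
          ∃ v, v ≠ 0 ∧ ∀ j : Fin i, (P.long j).transferT (ω.1.aLong j) *ᵥ (ω.1.K j *ᵥ v) ∈
            LinearMap.range ((P.long j).transferQ (ω.1.aLong j) (C j)).mulVecLin) ≤
        c / Fintype.card F := by
    by_cases h : P.b + ∑ j : Fin i, z j ≤ ∑ j : Fin i, (P.long j).capacity
    · obtain ⟨c, hc⟩ := Session.exists_prob_long_not_separated_le P z i h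
      exact ⟨c, fun _ => hc⟩
    · exact ⟨0, fun h' => absurd h' h⟩
  set c₅ := (P.n * P.b) ^ Fintype.card (P.AllHashIdx i) with hc₅
  -- Each of the five bad events has probability at most `c / q`; for `q ≥ q₀` their sum is at most
  -- `ε`.
  obtain ⟨q₀, hq₀⟩ := exists_nat_gt (((c₁ + c₂ + c₃ + c₄ + c₅ : ℕ) : ℝ) / ε)
  refine ⟨q₀, fun F _ _ hF W A sel hA => ?_⟩
  have hq : (0 : ℝ) < Fintype.card F := by exact_mod_cast Fintype.card_pos
  have hε' : (c₁ / Fintype.card F + c₂ / Fintype.card F + c₃ / Fintype.card F +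
      c₄ / Fintype.card F + c₅ / Fintype.card F : ℝ) ≤ ε := by
    rw [← add_div, ← add_div, ← add_div, ← add_div, div_le_iff₀ hq]
    rw [div_lt_iff₀ hε] at hq₀
    have : (q₀ : ℝ) ≤ Fintype.card F := by exact_mod_cast hF
    push_cast at hq₀
    nlinarith
  have hpos : ∀ c : ℕ, (0 : ℝ) ≤ c / Fintype.card F := fun c => by positivity
  have g₁ := Session.prob_aLong_le (P := P) (i := i) (h₁ F)
  have g₂ := Session.prob_aShort_le (P := P) (i := i) (h₂ F)
  have g₃ := h₃ F
  have g₅ := Session.prob_exists_plausible_ne_le P hc (fun j => (hz j).le.trans (hcap j))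
    (fun j => (hσ j).trans (hcaps j)) hm W A hA
  have huniq : ∀ ω : P.Coding F i × P.Secret F i, (¬ ∃ W', W' ≠ W ∧ P.Plausible W A ω W') →
      ∀ W', P.Plausible W A ω W' → W' = W := fun ω h W' hW' => by
    by_contra hne
    exact h ⟨W', hne, hW'⟩
  rw [Finset.sum_range, Finset.sum_range, Finset.sum_range]
  refine ⟨fun hcase => ?_, fun _ => ?_, fun hcase => ?_⟩
  · have g₄ := h₄ hcase F
    refine one_sub_le_prob ((prob_mono ?_).trans ((prob_or_le _ _).trans ((add_le_add
      ((prob_or_le _ _).trans (add_le_add ((prob_or_le _ _).trans (add_le_add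
        ((prob_or_le _ _).trans (add_le_add g₁ g₂)) g₃)) g₄)) g₅).trans hε')))
    intro ω hω
    by_contra! hgood
    obtain ⟨⟨⟨⟨e₁, e₂⟩, e₃⟩, e₄⟩, e₅⟩ := hgood
    refine hω (Session.result_eq_decoded ⟨?_, ?_⟩ fun W' hW' => ?_)
    · refine Session.X0_mem_rowSpace_recvLong W A _ _ fun v hv => ?_
      by_contra hne
      obtain ⟨j, hj⟩ := e₄ e₁ _ (fun j => (hA ω.1 (P.suffix ω.2 W) j).1) v hne
      exact hj (hv j)
    · refine Session.suffixMatrix_mem_rowSpace_recvShort A _ _ fun j v hv => ?_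
      by_contra hne
      exact e₃ e₂ j _ (hA ω.1 (P.suffix ω.2 W) j).2 v hne hv
    · by_contra hne
      exact e₅ W' hne hW'
  · refine one_sub_le_prob ((prob_mono ?_).trans (g₅.trans ?_))
    · intro ω hω
      by_contra h
      exact hω (Session.result_eq_wait_or_decoded (huniq ω h))
    · linarith [hpos c₁, hpos c₂, hpos c₃, hpos c₄]
  · refine one_sub_le_prob ((prob_mono ?_).trans ((prob_or_le _ _).trans
      ((add_le_add g₁ g₅).trans ?_)))
    · intro ω hω
      by_contra h
      obtain ⟨e₁, e₅⟩ := not_or.1 h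
      rw [not_not] at e₁
      refine hω fun hgen => Session.result_eq_wait fun W' hW' => ?_
      -- A plausible message must be the true one, whose rows then lie in the row space of `Y`; the
      -- rank count contradicts `hcase`.
      obtain rfl := huniq ω e₅ W' hW'
      have h6 := Session.card_le_of_genuineErrors W' A _ _ hgen hW'.1
      have h7 : ∑ j : Fin i, ((P.long j).transferQ (ω.1.aLong j)
          (A.locLong ω.1 (P.suffix ω.2 W') j)).rank = ∑ j : Fin i, z j :=
        Finset.sum_congr rfl fun j _ => (e₁ j _).trans (hA ω.1 (P.suffix ω.2 W') j).1
      omega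
    · linarith [hpos c₂, hpos c₃, hpos c₄]
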